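/- For an integer $n\ge 1$ let $\omega^*(n)$ be the number of distinct odd prime factors of $n$, let $\mathcal R'$ be the set of positive integers that can be written as $a^2+b^2$ with integers $a\ge 0$, $b\ge 1$ and $\gcd(a,b)=1$, and let $$r^*_{\mathcal R'}(n)=\#\{(a,b)\in\mathbb Z_{\ge 0}\times\mathcal R' : a^2+b^2=n,\ \gcd(a,b)=1\}.$$ Write $L=\log\log x$. **Theorem** (moments of $r^*_{\mathcal R'}$). For every fixed integer $\ell\ge 1$ and every integer $0\le k\ll L$, $$\sum_{\substack{n\le x\\ \omega^*(n)=k}}\binom{r^*_{\mathcal R'}(n)}{\ell}\ \ll_\ell\ \frac{xL^{O_\ell(1)}}{(\sqrt{\log x})^{\ell+1}}\cdot\frac{(2^{\ell-1}L)^k}{k!}.$$ Explicitly: for every integer $\ell\ge1$ there are real constants $A$ and $c>0$, depending only on $\ell$, such that for every real $C$ there is $x_0=x_0(\ell,C)$ with the property that for all real $x\ge x_0$ and all integers $0\le k\le CL$, $$\sum_{\substack{1\le n\le x\\ \omega^*(n)=k}}\binom{r^*_{\mathcal R'}(n)}{\ell}\ \le\ c\,\frac{xL^{A}}{(\sqrt{\log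 x})^{\ell+1}}\cdot\frac{(2^{\ell-1}L)^k}{k!}.$$ -/

import Mathlib

namespace SumSq

/-- `ω*(n)`: the number of distinct odd prime factors of `n`. -/
def omegaStar (n : ℕ) : ℕ := (n.primeFactors.filter (fun p => Odd p)).card

/-- `r_S(n)`: the number of pairs `(a, b)` with `a ≥ 0` an integer and `b ∈ S` such that
`a² + b² = n`. Here `S` is a set of natural numbers. -/
noncomputable def rep (S : Set ℕ) (n : ℕ) : ℕ :=
  Set.ncard {ab : ℕ × ℕ | ab.2 ∈ S ∧ ab.1 ^ 2 + ab.2 ^ 2 = n}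

/-- `r_S^*(n)`: the number of pairs counted by `r_S(n)` in which `a` and `b` are coprime. -/
noncomputable def repStar (S : Set ℕ) (n : ℕ) : ℕ :=
  Set.ncard {ab : ℕ × ℕ | ab.2 ∈ S ∧ ab.1 ^ 2 + ab.2 ^ 2 = n ∧ Nat.gcd ab.1 ab.2 = 1}

/-- `r_0(n)`: the number of `a ≥ 0`, `b ≥ 1` with `a² + b² = n`. -/
noncomputable def r0 (n : ℕ) : ℕ := rep {b | 1 ≤ b} n

/-- `r_0^*(n)`: the number of coprime `a ≥ 0`, `b ≥ 1` with `a² + b² = n`. -/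
noncomputable def r0Star (n : ℕ) : ℕ := repStar {b | 1 ≤ b} n

/-- `R`: the positive integers that are a sum of two squares. -/
def R : Set ℕ := {k | 1 ≤ r0 k}

/-- `R'`: the positive integers that are a sum of two coprime squares. -/
def R' : Set ℕ := {k | k ∈ R ∧ 1 ≤ r0Star k}

/-- The sets of pairs counted by `rep` are finite, so their `Set.ncard` is their true size. -/
theorem rep_finite (S : Set ℕ) (n : ℕ) :
    {ab : ℕ × ℕ | ab.2 ∈ S ∧ ab.1 ^ 2 + ab.2 ^ 2 = n}.Finite := by
  refine ((Set.finite_Iic n).prod (Set.finite_Iic n)).subset ?_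
  rintro ⟨a, b⟩ ⟨-, h⟩
  simp only [Set.mem_prod, Set.mem_Iic] at h ⊢
  constructor <;> nlinarith [Nat.le_self_pow two_ne_zero a, Nat.le_self_pow two_ne_zero b]

/-- The sets of pairs counted by `repStar` are finite. -/
theorem repStar_finite (S : Set ℕ) (n : ℕ) :
    {ab : ℕ × ℕ | ab.2 ∈ S ∧ ab.1 ^ 2 + ab.2 ^ 2 = n ∧ Nat.gcd ab.1 ab.2 = 1}.Finite :=
  (rep_finite S n).subset (fun _ h => ⟨h.1, h.2.1⟩)

end SumSq

/-! Write `L = log log x` and `ℓ = K + 1`. Only integers `n` with a primitive representation matter,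
and `-1` is a square modulo such an `n`. Outside a negligible set, `n = m * p` with a prime `p ≡ 1
(mod 4)` exceeding `y = exp (log x / L ^ 2)` and `ω*(m) = k - 1`
(`exists_large_prime_or_square_dvd`). The exceptions satisfy `n ≤ √x` or have a square divisor `s ^
2` with `s ^ 3 > y`. The trivial bound `(4 * 2 ^ k) ^ ℓ` for the binomial coefficient suffices
there, because `k ≪ L` makes it a power of `log x`.

Let `p = u ^ 2 + v ^ 2`. In the Gaussian integers a primitive representation `(a, b)` of `m * p` is
a primitive representation of `m` times `u ± iv`, so `b = |t.1 * v + t.2 * u|` for some primitive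
representation `t` of `m`. Hence `ℓ` representations with `b ∈ R'` give `ℓ` pairwise
non-proportional linear forms in `(u, v)` (`choose_repStar_le`) whose values have no prime factor `≡
3 (mod 4)` (`not_dvd_of_mem_R'`).

Fix `m`, the set of forms and `v`, and sieve `u`. A prime `q ≡ 1 (mod 4)` excludes two classes,
since `u ^ 2 + v ^ 2` is a large prime. A prime `q ≡ 3 (mod 4)` excludes `K` classes, one form being
dropped because it may not involve `u`. By Mertens modulo `4` each excluded class saves `exp (-L /
2)` up to powers of `L`, in total `exp (-(K + 2) * L / 2) = (√(log x)) ^ (-(ℓ + 1))`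
(`exists_card_linear_forms_le`). Brun's pure sieve is enough: sieving only up to `exp (log x / L ^
4)` loses just powers of `L`, which the theorem tolerates.

There are at most `(4 * 2 ^ (k - 1)) ^ ℓ` sets of forms. All odd primes dividing `m` are `≡ 1 (mod
4)`, so the sum of `1 / m` is `≪ (L / 2 + O(1)) ^ (k - 1) / (k - 1)!` (`sum_splitNumbers_le`). Since
`2 ^ ℓ * (L / 2) = 2 ^ (ℓ - 1) * L`, this is the claimed main term. -/

namespace SumSq

open Finset

/-! ### Mertens' theorems for primes in the classes 1 and 3 modulo 4. -/

section Mertens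

open ArithmeticFunction
open scoped ArithmeticFunction.zeta

/-- Abel's inequality: a sequence with partial sums bounded by `B`, weighted by a nonnegative
antitone sequence `f`, has weighted partial sums bounded by `B * f m`. -/
theorem abs_sum_Ico_mul_le {a f : ℕ → ℝ} {B : ℝ} {m : ℕ}
    (hS : ∀ n, m ≤ n → |∑ i ∈ Ico m n, a i| ≤ B) (hf : ∀ n, m ≤ n → f (n + 1) ≤ f n)
    (hf0 : ∀ n, m ≤ n → 0 ≤ f n) (n : ℕ) (hn : m ≤ n) :
    |∑ i ∈ Ico m n, a i * f i| ≤ B * f m := by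
  have hB : 0 ≤ B := (abs_nonneg _).trans (hS m le_rfl)
  rcases hn.eq_or_lt with rfl | hlt
  · simpa using mul_nonneg hB (hf0 m le_rfl)
  have key : ∀ n, m ≤ n → |∑ i ∈ Ico m (n + 1), a i * f i - (∑ i ∈ Ico m (n + 1), a i) * f n|
      ≤ B * (f m - f n) := by
    intro n hn
    induction n, hn using Nat.le_induction with
    | base => simp
    | succ n hn ih =>
      have e : ∑ i ∈ Ico m (n + 1 + 1), a i * f i - (∑ i ∈ Ico m (n + 1 + 1), a i) * f (n + 1)
          = (∑ i ∈ Ico m (n + 1), a i * f i - (∑ i ∈ Ico m (n + 1), a i) * f n)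
            + (∑ i ∈ Ico m (n + 1), a i) * (f n - f (n + 1)) := by
        rw [sum_Ico_succ_top (by omega), sum_Ico_succ_top (a := m) (b := n + 1) (by omega)]
        ring
      rw [e]
      refine (abs_add_le _ _).trans ?_
      rw [abs_mul, abs_of_nonneg (sub_nonneg.2 (hf n hn))]
      have := mul_le_mul_of_nonneg_right (hS (n + 1) (by omega)) (sub_nonneg.2 (hf n hn))
      linarith
  obtain ⟨k, rfl⟩ : ∃ k, n = k + 1 := ⟨n - 1, by omega⟩
  have h1 := key k (by omega)
  have h2 := mul_le_mul_of_nonneg_right (hS (k + 1) hn) (hf0 k (by omega))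
  rw [← abs_of_nonneg (hf0 k (by omega)), ← abs_mul, abs_of_nonneg (hf0 k (by omega))] at h2
  have h3 := abs_add_le (∑ i ∈ Ico m (k + 1), a i * f i - (∑ i ∈ Ico m (k + 1), a i) * f k)
    ((∑ i ∈ Ico m (k + 1), a i) * f k)
  rw [sub_add_cancel] at h3
  linarith

/-- The nontrivial Dirichlet character modulo `4`, as a real function. -/
noncomputable def chi (n : ℕ) : ℝ := ((ZMod.χ₄ (n : ZMod 4) : ℤ) : ℝ)

theorem chi_mul (m n : ℕ) : chi (m * n) = chi m * chi n := by
  rw [chi, chi, chi, Nat.cast_mul, map_mul, Int.cast_mul]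

theorem chi_eq (n : ℕ) : chi n = if n % 4 = 1 then 1 else if n % 4 = 3 then -1 else 0 := by
  rw [chi, ZMod.χ₄_nat_eq_if_mod_four]
  have : n % 4 < 4 := Nat.mod_lt _ (by norm_num)
  split_ifs <;> first | omega | simp

theorem abs_chi_le (n : ℕ) : |chi n| ≤ 1 := by
  rw [chi_eq]; split_ifs <;> simp

theorem sum_range_chi (n : ℕ) :
    ∑ i ∈ range n, chi i = if n % 4 = 2 ∨ n % 4 = 3 then 1 else 0 := by
  induction n with
  | zero => simp
  | succ n ih =>
    rw [sum_range_succ, ih, chi_eq]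
    have : n % 4 < 4 := Nat.mod_lt _ (by norm_num)
    split_ifs <;> first | omega | norm_num

theorem abs_sum_Ico_chi_le (m n : ℕ) (h : m ≤ n) : |∑ i ∈ Ico m n, chi i| ≤ 1 := by
  rw [sum_Ico_eq_sub _ h, sum_range_chi, sum_range_chi]
  split_ifs <;> simp

theorem abs_sum_chi_div_le (m n : ℕ) (hm : 1 ≤ m) (h : m ≤ n) :
    |∑ i ∈ Ico m n, chi i / i| ≤ 1 / m := by
  have := abs_sum_Ico_mul_le (a := chi) (f := fun i => 1 / (i : ℝ)) (B := 1) (m := m)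
    (fun n hn => abs_sum_Ico_chi_le m n hn) (fun n hn => ?_) (fun n hn => by positivity) n h
  · simpa [div_eq_mul_inv] using this
  · have : (0 : ℝ) < n := by exact_mod_cast (by omega : 0 < n)
    push_cast
    gcongr
    linarith

theorem exists_sum_chi_div_log_bound :
    ∃ B : ℝ, ∀ N : ℕ, |∑ n ∈ Ioc 0 N, chi n * Real.log n / n| ≤ B := by
  refine ⟨Real.log 2 + Real.log 3 + 1, fun N => ?_⟩
  have e : ∀ N : ℕ, Ioc 0 N = Ico 1 (N + 1) := fun N => by ext; simp; omega
  rw [e]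
  have hl2 : 0 ≤ Real.log 2 := Real.log_nonneg (by norm_num)
  have hl3 : 0 ≤ Real.log 3 := Real.log_nonneg (by norm_num)
  by_cases hN : N + 1 ≤ 3
  · have : N = 0 ∨ N = 1 ∨ N = 2 := by omega
    rcases this with rfl | rfl | rfl
    · simp; linarith
    · simp; linarith
    · rw [show Ico 1 (2 + 1) = {1, 2} from rfl]
      simp [chi_eq]; linarith
  push Not at hN
  -- `log n / n` decreases only from `e` on, so Abel's inequality starts at 3.
  rw [← sum_Ico_consecutive _ (show 1 ≤ 3 by norm_num) hN.le]
  have h1 : ∑ n ∈ Ico 1 3, chi n * Real.log n / n = 0 := by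
    rw [show Ico 1 3 = {1, 2} from rfl]; simp [chi_eq]
  rw [h1, zero_add]
  have := abs_sum_Ico_mul_le (a := chi) (f := fun i => Real.log i / (i : ℝ)) (B := 1) (m := 3)
    (fun n hn => abs_sum_Ico_chi_le 3 n hn) (fun n hn => ?_) (fun n hn => by positivity) (N + 1) hN.le
  · simp only [← mul_div_assoc] at this
    refine this.trans ?_
    push_cast
    linarith
  · have he : Real.exp 1 ≤ 3 := by linarith [Real.exp_one_lt_d9]
    have hn' : (3 : ℝ) ≤ n := by exact_mod_cast hn
    refine Real.log_div_self_antitoneOn ?_ ?_ ?_ <;> simp <;> linarith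

/-- The value `L(1, χ₄)`, characterised by its speed of convergence. -/
theorem exists_sum_chi_div_limit :
    ∃ l : ℝ, 0 < l ∧ ∀ N : ℕ, |∑ n ∈ Ioc 0 N, chi n / n - l| ≤ 1 / (N + 1) := by
  have e : ∀ N : ℕ, Ioc 0 N = Ico 1 (N + 1) := fun N => by ext; simp; omega
  set F : ℕ → ℝ := fun N => ∑ n ∈ Ioc 0 N, chi n / n with hF
  have hd : ∀ M N, M ≤ N → |F N - F M| ≤ 1 / (M + 1) := by
    intro M N h
    have := abs_sum_chi_div_le (M + 1) (N + 1) (by omega) (by omega)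
    simp only [hF, e]
    rw [← sum_Ico_consecutive _ (show 1 ≤ M + 1 by omega) (show M + 1 ≤ N + 1 by omega)]
    simpa using this
  have hc : CauchySeq F := by
    refine cauchySeq_of_le_tendsto_0 (fun N : ℕ => 2 * (1 / ((N : ℝ) + 1))) ?_ ?_
    · intro n m N hn hm
      have h1 := hd N n hn
      have h2 := hd N m hm
      rw [Real.dist_eq]
      rw [abs_le] at *
      constructor <;> linarith
    · simpa using (tendsto_one_div_add_atTop_nhds_zero_nat (𝕜 := ℝ)).const_mul 2
  obtain ⟨l, hl⟩ := cauchySeq_tendsto_of_complete hc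
  have hb : ∀ N : ℕ, |F N - l| ≤ 1 / (N + 1) := by
    intro N
    rw [abs_sub_comm]
    have : Filter.Tendsto (fun M => |F M - F N|) Filter.atTop (nhds |l - F N|) :=
      (hl.sub_const _).abs
    exact le_of_tendsto this (Filter.eventually_atTop.2 ⟨N, fun M hM => hd N M hM⟩)
  refine ⟨l, ?_, hb⟩
  -- The partial sum `1 - 1/3 = 2/3` is within `1/4` of the limit, which is therefore positive.
  have h3 := hb 3
  have : F 3 = 2 / 3 := by
    simp only [hF]
    rw [show Ioc 0 3 = {1, 2, 3} from rfl]
    simp [chi_eq]; norm_num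
  rw [this, abs_le] at h3
  norm_num at h3
  linarith [h3.2]

theorem sum_vonMangoldt_le : ∃ B : ℝ, 0 < B ∧ ∀ N : ℕ, ∑ n ∈ Ioc 0 N, Λ n ≤ B * N := by
  refine ⟨Real.log 4 + 4, by positivity, fun N => ?_⟩
  have := Chebyshev.psi_le_const_mul_self (x := N) (by positivity)
  simpa [Chebyshev.psi] using this

/-- Since `log = Λ * 1` and the character is completely multiplicative, `χ log = (χΛ) * χ`. In the
resulting double sum the inner sum of `χ(m) / m` is `L(1, χ) + O(n / N)`; Chebyshev's bound absorbs
the error, and one divides by `L(1, χ) > 0`. -/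
theorem exists_abs_sum_chi_vonMangoldt_le :
    ∃ B : ℝ, ∀ N : ℕ, |∑ n ∈ Ioc 0 N, chi n * Λ n / n| ≤ B := by
  obtain ⟨B₁, hB₁⟩ := exists_sum_chi_div_log_bound
  obtain ⟨l, hl, hl'⟩ := exists_sum_chi_div_limit
  obtain ⟨B₂, hB₂, hψ⟩ := sum_vonMangoldt_le
  refine ⟨(B₁ + B₂) / l, fun N => ?_⟩
  let f : ArithmeticFunction ℝ := ⟨fun n => chi n * Λ n / n, by simp⟩
  let g : ArithmeticFunction ℝ := ⟨fun n => chi n / n, by simp⟩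
  have hfg : ∀ n, (f * g) n = chi n * Real.log n / n := by
    intro n
    rw [mul_apply, ← vonMangoldt_sum, mul_sum, sum_div,
      ← Nat.sum_divisorsAntidiagonal (fun i _ => chi n * Λ i / n)]
    refine sum_congr rfl fun x hx => ?_
    have := (Nat.mem_divisorsAntidiagonal.1 hx).1
    rw [← this, chi_mul]
    simp only [f, g, coe_mk]
    push_cast
    rw [div_mul_div_comm]
    ring
  have h := sum_Ioc_mul_eq_sum_sum f g N
  simp only [hfg] at h
  rcases Nat.eq_zero_or_pos N with rfl | hN
  · have : 0 ≤ B₁ := (abs_nonneg _).trans (hB₁ 0)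
    simp; positivity
  have hN' : (0 : ℝ) < N := by exact_mod_cast hN
  have hdiff : |∑ n ∈ Ioc 0 N, f n * ((∑ m ∈ Ioc 0 (N / n), g m) - l)| ≤ B₂ := by
    refine (abs_sum_le_sum_abs _ _).trans ?_
    have : ∀ n ∈ Ioc 0 N, |f n * ((∑ m ∈ Ioc 0 (N / n), g m) - l)| ≤ Λ n / N := by
      intro n hn
      have hn0 : (0 : ℝ) < n := by exact_mod_cast (mem_Ioc.1 hn).1
      rw [abs_mul]
      have h1 : |f n| ≤ Λ n / n := by
        simp only [f, coe_mk]
        rw [abs_div, abs_mul, abs_of_nonneg vonMangoldt_nonneg, abs_of_pos hn0]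
        gcongr
        exact mul_le_of_le_one_left vonMangoldt_nonneg (abs_chi_le n)
      have h2 : |(∑ m ∈ Ioc 0 (N / n), g m) - l| ≤ n / N := by
        refine (hl' (N / n)).trans ?_
        rw [div_le_div_iff₀ (by positivity) hN']
        have : N < n * (N / n + 1) := Nat.lt_mul_div_succ N (mem_Ioc.1 hn).1
        have : (N : ℝ) ≤ n * ((N / n : ℕ) + 1) := by exact_mod_cast this.le
        linarith
      calc |f n| * |(∑ m ∈ Ioc 0 (N / n), g m) - l| ≤ (Λ n / n) * (n / N) := by
            gcongr
        _ = Λ n / N := by field_simp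
    refine (sum_le_sum this).trans ?_
    rw [← sum_div, div_le_iff₀ hN']
    exact hψ N
  have hsplit : l * ∑ n ∈ Ioc 0 N, chi n * Λ n / n = ∑ n ∈ Ioc 0 N, chi n * Real.log n / n
      - ∑ n ∈ Ioc 0 N, f n * ((∑ m ∈ Ioc 0 (N / n), g m) - l) := by
    rw [h, ← sum_sub_distrib, mul_sum]
    refine sum_congr rfl fun n _ => ?_
    simp only [f, coe_mk]
    ring
  rw [le_div_iff₀ hl, mul_comm]
  nth_rw 1 [← abs_of_pos hl]
  rw [← abs_mul, hsplit]
  exact (abs_sub _ _).trans (add_le_add (hB₁ N) hdiff)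

/-- Evaluate `log N! = ∑ Λ(n) ⌊N / n⌋` in two ways; removing the floors costs `O(N)` by Chebyshev.
-/
theorem exists_abs_sum_vonMangoldt_div_sub_log_le :
    ∃ B : ℝ, ∀ N : ℕ, 1 ≤ N → |∑ n ∈ Ioc 0 N, Λ n / n - Real.log N| ≤ B := by
  obtain ⟨B₂, hB₂, hψ⟩ := sum_vonMangoldt_le
  refine ⟨B₂ + 1, fun N hN => ?_⟩
  have hN' : (0 : ℝ) < N := by exact_mod_cast hN
  have h := sum_Ioc_mul_zeta_eq_sum Λ N
  rw [vonMangoldt_mul_zeta] at h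
  have hfac : ∑ n ∈ Ioc 0 N, (log n : ℝ) = Real.log (N.factorial) := by
    have : ∀ N : ℕ, ∑ n ∈ Ioc 0 N, Real.log (n : ℝ) = Real.log (N.factorial) := by
      intro N
      induction N with
      | zero => simp
      | succ N ih =>
        rw [sum_Ioc_succ_top (by omega), ih,
          Nat.factorial_succ, Nat.cast_mul, Real.log_mul (by positivity) (by positivity)]
        push_cast; ring
    simpa using this N
  have hup : Real.log N.factorial ≤ N * Real.log N := by
    rw [← Real.log_pow]
    exact Real.log_le_log (by positivity) (by exact_mod_cast Nat.factorial_le_pow N)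
  have hlo : N * Real.log N - N ≤ Real.log N.factorial := by
    have h1 : (N : ℝ) ^ N / N.factorial ≤ Real.exp N := Real.pow_div_factorial_le_exp _ hN'.le N
    rw [div_le_iff₀ (by positivity)] at h1
    have h2 := Real.log_le_log (by positivity) h1
    rw [Real.log_mul (by positivity) (by positivity), Real.log_exp, Real.log_pow] at h2
    linarith
  have h3 : ∑ n ∈ Ioc 0 N, Λ n * ((N / n : ℕ) : ℝ) = Real.log N.factorial := by
    rw [← hfac, h]
  have h4 : ∑ n ∈ Ioc 0 N, Λ n * ((N / n : ℕ) : ℝ) ≤ N * ∑ n ∈ Ioc 0 N, Λ n / n := by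
    rw [mul_sum]
    refine sum_le_sum fun n _ => ?_
    have := Nat.cast_div_le (α := ℝ) (m := N) (n := n)
    calc Λ n * ((N / n : ℕ) : ℝ) ≤ Λ n * (N / n) := by gcongr
      _ = _ := by ring
  have h5 : N * ∑ n ∈ Ioc 0 N, Λ n / n ≤ ∑ n ∈ Ioc 0 N, Λ n * ((N / n : ℕ) : ℝ)
      + ∑ n ∈ Ioc 0 N, Λ n := by
    rw [mul_sum, ← sum_add_distrib]
    refine sum_le_sum fun n hn => ?_
    have hn0 : (0 : ℝ) < n := by exact_mod_cast (mem_Ioc.1 hn).1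
    have : N < n * (N / n + 1) := Nat.lt_mul_div_succ N (mem_Ioc.1 hn).1
    have : (N : ℝ) ≤ n * ((N / n : ℕ) + 1) := by exact_mod_cast this.le
    have : (N : ℝ) / n ≤ ((N / n : ℕ) + 1) := by rw [div_le_iff₀ hn0]; linarith
    calc N * (Λ n / n) = Λ n * (N / n) := by ring
      _ ≤ Λ n * ((N / n : ℕ) + 1) := by gcongr
      _ = _ := by ring
  have h6 := hψ N
  rw [abs_le]
  constructor
  · have : N * (Real.log N - 1) ≤ N * ∑ n ∈ Ioc 0 N, Λ n / n := by linarith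
    have := le_of_mul_le_mul_left this hN'
    linarith
  · have : N * ∑ n ∈ Ioc 0 N, Λ n / n ≤ N * (Real.log N + B₂) := by linarith
    have := le_of_mul_le_mul_left this hN'
    linarith

theorem exists_sum_nonprime_vonMangoldt_div_le :
    ∃ B : ℝ, ∀ N : ℕ, ∑ n ∈ Ioc 0 N with ¬ n.Prime, Λ n / n ≤ B := by
  obtain ⟨C, hC⟩ := Chebyshev.psi_sub_theta_le_mul_sqrt
  set b : ℕ → ℝ := fun n => if ¬ n.Prime then Λ n else 0 with hb
  have hS : ∀ N : ℕ, ∑ n ∈ Ioc 0 N, b n ≤ C * √N := by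
    intro N
    have h := hC N
    rw [Chebyshev.psi_sub_theta_eq_sum_not_prime, Nat.floor_natCast, sum_filter] at h
    exact h
  have hC0 : 0 ≤ C := by
    have h := hS 1
    have : b 1 = 0 := by simp [hb]
    simpa [this] using h
  -- Partial summation against the bound `C * √N`: each step adds at most `C * √N / (N * (N + 1))`,
  -- which is dominated by the increment of `C * (2 - 2 / √N)`.
  have key : ∀ N : ℕ, 1 ≤ N →
      ∑ n ∈ Ioc 0 N, b n / n ≤ (∑ n ∈ Ioc 0 N, b n) / N + C * (2 - 2 / √N) := by
    intro N hN
    induction N, hN using Nat.le_induction with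
    | base => simp
    | succ N hN ih =>
      rw [sum_Ioc_succ_top (by omega), sum_Ioc_succ_top (by omega)]
      have hN0 : (0 : ℝ) < N := by exact_mod_cast hN
      have hs := hS N
      push_cast
      set s := √(N : ℝ) with hs'
      set t := √((N : ℝ) + 1) with ht'
      have hs0 : 0 < s := Real.sqrt_pos.2 hN0
      have ht0 : 0 < t := Real.sqrt_pos.2 (by linarith)
      have hss : s ^ 2 = N := Real.sq_sqrt hN0.le
      have htt : t ^ 2 = N + 1 := Real.sq_sqrt (by linarith)
      have hst : s ≤ t := Real.sqrt_le_sqrt (by linarith)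
      have h1 : (1 : ℝ) / N - 1 / (N + 1) = 1 / (s ^ 2 * t ^ 2) := by
        rw [hss, htt]; field_simp; ring
      have h2 : s * (1 / (s ^ 2 * t ^ 2)) ≤ 2 / s - 2 / t := by
        have e1 : s * (1 / (s ^ 2 * t ^ 2)) = 1 / (s * t ^ 2) := by field_simp
        have e2 : 2 / s - 2 / t = 2 * (t - s) / (s * t) := by field_simp
        have e3 : (t - s) * (t + s) = 1 := by nlinarith
        rw [e1, e2, div_le_div_iff₀ (by positivity) (by positivity)]
        have : 1 ≤ 2 * (t - s) * t := by nlinarith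
        calc 1 * (s * t) ≤ (2 * (t - s) * t) * (s * t) := by gcongr
          _ = _ := by ring
      have h3 : (∑ n ∈ Ioc 0 N, b n) * (1 / N - 1 / (N + 1)) ≤ C * (2 / s - 2 / t) := by
        rw [h1]
        calc _ ≤ (C * s) * (1 / (s ^ 2 * t ^ 2)) := by gcongr
          _ = C * (s * (1 / (s ^ 2 * t ^ 2))) := by ring
          _ ≤ _ := by gcongr
      have e : (∑ n ∈ Ioc 0 N, b n + b (N + 1)) / ((N : ℝ) + 1) + C * (2 - 2 / t)
          = (∑ n ∈ Ioc 0 N, b n) / N + C * (2 - 2 / s) + b (N + 1) / (N + 1)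
            - (∑ n ∈ Ioc 0 N, b n) * (1 / N - 1 / (N + 1)) + C * (2 / s - 2 / t) := by ring
      rw [e]
      linarith
  refine ⟨3 * C, fun N => ?_⟩
  have e : ∑ n ∈ Ioc 0 N with ¬ n.Prime, Λ n / n = ∑ n ∈ Ioc 0 N, b n / n := by
    rw [sum_filter]
    refine sum_congr rfl fun n _ => ?_
    simp only [hb]; split_ifs <;> simp
  rw [e]
  rcases Nat.eq_zero_or_pos N with rfl | hN
  · simpa using hC0
  · have hN0 : (1 : ℝ) ≤ N := by exact_mod_cast hN
    refine (key N hN).trans ?_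
    have h1 : (∑ n ∈ Ioc 0 N, b n) / N ≤ C := by
      rw [div_le_iff₀ (by linarith)]
      refine (hS N).trans ?_
      gcongr
      rw [Real.sqrt_le_left (by linarith)]
      nlinarith
    have h2 : 0 ≤ C * (2 / √(N : ℝ)) := by positivity
    linarith

theorem exists_abs_sum_prime_weight_sub_le {w : ℕ → ℝ} (hw : ∀ n, |w n| ≤ 1) {g : ℕ → ℝ} {B : ℝ}
    (h : ∀ N : ℕ, 1 ≤ N → |∑ n ∈ Ioc 0 N, w n * Λ n / n - g N| ≤ B) :
    ∃ B' : ℝ, ∀ N : ℕ, 1 ≤ N →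
      |∑ p ∈ Ioc 0 N with p.Prime, w p * (Real.log p / p) - g N| ≤ B' := by
  obtain ⟨C, hC⟩ := exists_sum_nonprime_vonMangoldt_div_le
  refine ⟨B + C, fun N hN => ?_⟩
  have e := sum_filter_add_sum_filter_not (Ioc 0 N) Nat.Prime (fun n => w n * Λ n / n)
  have e1 : ∑ n ∈ Ioc 0 N with n.Prime, w n * Λ n / n
      = ∑ p ∈ Ioc 0 N with p.Prime, w p * (Real.log p / p) := by
    refine sum_congr rfl fun p hp => ?_
    rw [vonMangoldt_apply_prime (mem_filter.1 hp).2, mul_div_assoc]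
  have e2 : |∑ n ∈ Ioc 0 N with ¬ n.Prime, w n * Λ n / n| ≤ C := by
    refine (abs_sum_le_sum_abs _ _).trans (le_trans (sum_le_sum fun n _ => ?_) (hC N))
    rw [abs_div, abs_mul, abs_of_nonneg vonMangoldt_nonneg, Nat.abs_cast]
    gcongr
    exact mul_le_of_le_one_left vonMangoldt_nonneg (hw n)
  rw [← e1]
  have h3 := h N hN
  rw [← e] at h3
  rw [abs_le] at *
  constructor <;> linarith

/-- Mertens' first theorem for the residue classes `1` and `3` modulo `4`. -/
theorem exists_abs_sum_log_div_prime_mod_four_le :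
    ∃ B : ℝ, ∀ a : ℕ, (a = 1 ∨ a = 3) → ∀ N : ℕ, 1 ≤ N →
      |∑ p ∈ Ioc 0 N with p.Prime ∧ p % 4 = a, Real.log p / p - Real.log N / 2| ≤ B := by
  obtain ⟨B₁, hB₁⟩ := exists_abs_sum_vonMangoldt_div_sub_log_le
  obtain ⟨B₂, hB₂⟩ := exists_abs_sum_chi_vonMangoldt_le
  obtain ⟨C₁, hC₁⟩ := exists_abs_sum_prime_weight_sub_le (w := fun _ => 1) (by simp)
    (g := fun N => Real.log N) (B := B₁) (by simpa using hB₁)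
  obtain ⟨C₂, hC₂⟩ := exists_abs_sum_prime_weight_sub_le (w := chi) abs_chi_le
    (g := fun _ => 0) (B := B₂) (by simpa using fun N _ => hB₂ N)
  refine ⟨(C₁ + C₂ + 1) / 2, fun a ha N hN => ?_⟩
  have h1 := hC₁ N hN
  have h2 := hC₂ N hN
  simp only [one_mul, sub_zero] at h1 h2
  set s : ℝ := if a = 1 then 1 else -1 with hs
  have hs1 : |s| = 1 := by rw [hs]; split_ifs <;> simp
  have key : ∑ p ∈ Ioc 0 N with p.Prime ∧ p % 4 = a, Real.log p / p
      = (∑ p ∈ Ioc 0 N with p.Prime, Real.log p / p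
        + s * ∑ p ∈ Ioc 0 N with p.Prime, chi p * (Real.log p / p)
        - ∑ p ∈ Ioc 0 N with p.Prime, if p = 2 then Real.log 2 / 2 else 0) / 2 := by
    -- On odd primes `(1 + s * χ) / 2` is the indicator of the class `a`; the prime 2, where `χ`
    -- vanishes, is subtracted separately.
    rw [mul_sum, ← sum_add_distrib, ← sum_sub_distrib, sum_div, ← filter_filter, sum_filter]
    refine sum_congr rfl fun p hp => ?_
    have hp := (mem_filter.1 hp).2
    rcases hp.eq_two_or_odd with rfl | ho
    · rcases ha with rfl | rfl <;> simp [chi_eq]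
    · have h2 : p ≠ 2 := by rintro rfl; omega
      have h4 : p % 4 = 1 ∨ p % 4 = 3 := by omega
      rw [if_neg h2, hs]
      rcases ha with rfl | rfl <;> rcases h4 with h4 | h4 <;> simp [chi_eq, h4]
  have h3 : |∑ p ∈ Ioc 0 N with p.Prime, if p = 2 then Real.log 2 / 2 else 0| ≤ 1 := by
    rw [sum_ite_eq']
    have := Real.log_two_lt_d9
    have := Real.log_nonneg (show (1 : ℝ) ≤ 2 by norm_num)
    split_ifs
    · rw [abs_of_nonneg (by positivity)]; linarith
    · simp
  have h4 : |s * ∑ p ∈ Ioc 0 N with p.Prime, chi p * (Real.log p / p)| ≤ C₂ := by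
    rw [abs_mul, hs1, one_mul]; exact h2
  rw [key]
  rw [abs_le] at *
  constructor <;> linarith

/-- A Riemann sum for `∫ d(log t) / log t`, to be compared with `log log N`. -/
theorem exists_abs_sum_log_sub_div_log_le :
    ∃ B : ℝ, ∀ N : ℕ, 2 ≤ N →
      |∑ n ∈ Ico 2 (N + 1), (Real.log n - Real.log (n - 1 : ℕ)) / Real.log n
        - Real.log (Real.log N)| ≤ B := by
  have hl2 : 0 < Real.log 2 := Real.log_pos (by norm_num)
  have hl2' : Real.log 2 ≤ 1 := by linarith [Real.log_two_lt_d9]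
  have step : ∀ N : ℕ, 2 ≤ N → 0 < Real.log N ∧ Real.log N ≤ Real.log (N + 1 : ℕ) ∧
      Real.log (N + 1 : ℕ) - Real.log N ≤ 1 := by
    intro N hN
    have hN' : (2 : ℝ) ≤ N := by exact_mod_cast hN
    refine ⟨Real.log_pos (by linarith), Real.log_le_log (by linarith) (by push_cast; linarith), ?_⟩
    have : Real.log (N + 1 : ℕ) ≤ Real.log (2 * N) :=
      Real.log_le_log (by positivity) (by push_cast; linarith)
    rw [Real.log_mul (by norm_num) (by positivity)] at this
    linarith
  set D : ℕ → ℝ := fun N => ∑ n ∈ Ico 2 (N + 1), (Real.log n - Real.log (n - 1 : ℕ)) / Real.log n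
  have hD2 : D 2 = 1 := by
    simp only [D]
    rw [show Ico 2 (2 + 1) = {2} from rfl]
    simp [hl2.ne']
  have hDs : ∀ N, 2 ≤ N → D (N + 1) = D N
      + (Real.log (N + 1 : ℕ) - Real.log N) / Real.log (N + 1 : ℕ) := by
    intro N hN
    simp only [D]
    rw [sum_Ico_succ_top (by omega)]
    simp
  have up : ∀ N : ℕ, 2 ≤ N → D N ≤ Real.log (Real.log N) + (1 - Real.log (Real.log 2)) := by
    intro N hN
    induction N, hN using Nat.le_induction with
    | base => rw [hD2]; simp
    | succ N hN ih =>
      obtain ⟨h0, h1, h2⟩ := step N hN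
      rw [hDs N hN]
      have := Real.one_sub_inv_le_log_of_pos (div_pos (h0.trans_le h1) h0)
      rw [Real.log_div (h0.trans_le h1).ne' h0.ne', inv_div] at this
      rw [sub_div, div_self (h0.trans_le h1).ne']
      linarith
  -- The extra `1 / log N` makes the induction close: with `u`, `v` consecutive logarithms, the
  -- error per step is at most `(v - u) ^ 2 / (u * v) ≤ 1 / u - 1 / v`, as `v - u ≤ 1`.
  have lo : ∀ N : ℕ, 2 ≤ N → Real.log (Real.log N) - D N + 1 / Real.log N ≤
      Real.log (Real.log 2) - 1 + 1 / Real.log 2 := by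
    intro N hN
    induction N, hN using Nat.le_induction with
    | base => rw [hD2]; simp
    | succ N hN ih =>
      obtain ⟨h0, h1, h2⟩ := step N hN
      rw [hDs N hN]
      have hp := h0.trans_le h1
      have h3 := Real.log_le_sub_one_of_pos (div_pos hp h0)
      rw [Real.log_div hp.ne' h0.ne'] at h3
      set u := Real.log N
      set v := Real.log (N + 1 : ℕ)
      have : v / u - 1 - (v - u) / v ≤ 1 / u - 1 / v := by
        have e1 : v / u - 1 - (v - u) / v = (v - u) * ((v - u) / (u * v)) := by field_simp
        have e2 : 1 / u - 1 / v = 1 * ((v - u) / (u * v)) := by field_simp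
        rw [e1, e2]
        have : 0 ≤ (v - u) / (u * v) := div_nonneg (by linarith) (by positivity)
        gcongr
      linarith
  refine ⟨|1 - Real.log (Real.log 2)| + |Real.log (Real.log 2) - 1 + 1 / Real.log 2|,
    fun N hN => ?_⟩
  have h1 := up N hN
  have h2 := lo N hN
  have h3 : 0 < 1 / Real.log N := one_div_pos.2 (step N hN).1
  have h4 := le_abs_self (1 - Real.log (Real.log 2))
  have h5 := le_abs_self (Real.log (Real.log 2) - 1 + 1 / Real.log 2)
  have h6 := abs_nonneg (1 - Real.log (Real.log 2))
  have h7 := abs_nonneg (Real.log (Real.log 2) - 1 + 1 / Real.log 2)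
  rw [abs_le]
  constructor <;> linarith

theorem exists_abs_sum_inv_prime_mod_four_nat_le :
    ∃ B : ℝ, ∀ a : ℕ, (a = 1 ∨ a = 3) → ∀ N : ℕ, 2 ≤ N →
      |∑ p ∈ Ioc 0 N with p.Prime ∧ p % 4 = a, (1 / p : ℝ) - Real.log (Real.log N) / 2| ≤ B := by
  obtain ⟨B₁, hB₁⟩ := exists_abs_sum_log_div_prime_mod_four_le
  obtain ⟨B₂, hB₂⟩ := exists_abs_sum_log_sub_div_log_le
  refine ⟨B₁ * (1 / Real.log 2) + B₂ / 2, fun a ha N hN => ?_⟩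
  -- By the first theorem this sequence has bounded partial sums; Abel's inequality with weight `1 /
  -- log n` turns that into the second theorem.
  set b : ℕ → ℝ := fun n => (if n.Prime ∧ n % 4 = a then Real.log n / n else 0)
    - (Real.log n - Real.log (n - 1 : ℕ)) / 2 with hb
  have e : ∀ N : ℕ, 1 ≤ N → ∀ f : ℕ → ℝ, ∑ p ∈ Ioc 0 N with p.Prime ∧ p % 4 = a, f p
      = ∑ n ∈ Ico 2 (N + 1), if n.Prime ∧ n % 4 = a then f n else 0 := by
    intro N hN f
    rw [sum_filter, show Ioc 0 N = Ico 1 (N + 1) by ext; simp; omega,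
      ← sum_Ico_consecutive _ (show 1 ≤ 2 by norm_num) (by omega)]
    simp [Nat.not_prime_one]
  have tel : ∀ N : ℕ, 1 ≤ N → ∑ n ∈ Ico 2 (N + 1), (Real.log n - Real.log (n - 1 : ℕ)) / 2
      = Real.log N / 2 := by
    intro N hN
    induction N, hN using Nat.le_induction with
    | base => simp
    | succ N hN ih => rw [sum_Ico_succ_top (by omega), ih]; simp; ring
  have hS : ∀ n, 2 ≤ n → |∑ i ∈ Ico 2 n, b i| ≤ B₁ := by
    intro n hn
    obtain ⟨k, rfl⟩ : ∃ k, n = k + 1 := ⟨n - 1, by omega⟩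
    simp only [hb]
    rw [sum_sub_distrib, ← e k (by omega) (fun n => Real.log n / n), tel k (by omega)]
    exact hB₁ a ha k (by omega)
  have h1 := abs_sum_Ico_mul_le (f := fun n => 1 / Real.log n) hS (fun n hn => ?_)
    (fun n hn => by positivity) (N + 1) (by omega)
  · have h2 := hB₂ N hN
    have h3 : ∑ i ∈ Ico 2 (N + 1), b i * (1 / Real.log i)
        = ∑ p ∈ Ioc 0 N with p.Prime ∧ p % 4 = a, (1 / p : ℝ)
          - (∑ n ∈ Ico 2 (N + 1), (Real.log n - Real.log (n - 1 : ℕ)) / Real.log n) / 2 := by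
      rw [e N (by omega), sum_div, ← sum_sub_distrib]
      refine sum_congr rfl fun n hn => ?_
      have : (2 : ℝ) ≤ n := by exact_mod_cast (mem_Ico.1 hn).1
      have : 0 < Real.log n := Real.log_pos (by linarith)
      simp only [hb]
      split_ifs
      · field_simp
      · field_simp; ring
    rw [h3] at h1
    push_cast at h1
    rw [abs_le] at *
    constructor <;> linarith
  · have : (2 : ℝ) ≤ n := by exact_mod_cast hn
    have : 0 < Real.log n := Real.log_pos (by linarith)
    gcongr
    linarith

/-- Mertens' second theorem for the residue classes `1` and `3` modulo `4`. -/
theorem exists_abs_sum_inv_prime_mod_four_le :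
    ∃ B : ℝ, ∀ a : ℕ, (a = 1 ∨ a = 3) → ∀ t : ℝ, 2 ≤ t →
      |∑ p ∈ Ioc 0 ⌊t⌋₊ with p.Prime ∧ p % 4 = a, (1 / p : ℝ) - Real.log (Real.log t) / 2| ≤ B := by
  obtain ⟨B, hB⟩ := exists_abs_sum_inv_prime_mod_four_nat_le
  refine ⟨B + Real.log 2 / 2, fun a ha t ht => ?_⟩
  have h2 : 2 ≤ ⌊t⌋₊ := Nat.le_floor (by simpa using ht)
  have h := hB a ha _ h2
  have h2' : (2 : ℝ) ≤ ⌊t⌋₊ := by exact_mod_cast h2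
  have hf : (⌊t⌋₊ : ℝ) ≤ t := Nat.floor_le (by linarith)
  have hf' : t < ⌊t⌋₊ + 1 := Nat.lt_floor_add_one t
  have h0 : 0 < Real.log ⌊t⌋₊ := Real.log_pos (by linarith)
  have h1 : Real.log ⌊t⌋₊ ≤ Real.log t := Real.log_le_log (by linarith) hf
  -- As `t ≤ ⌊t⌋ ^ 2`, replacing `t` by its floor changes `log log t` by at most `log 2`.
  have h3 : Real.log t ≤ 2 * Real.log ⌊t⌋₊ := by
    have := Real.log_le_log (by linarith) (show t ≤ (⌊t⌋₊ : ℝ) ^ 2 by nlinarith)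
    rw [Real.log_pow] at this
    exact_mod_cast this
  have h4 := Real.log_le_log h0 h1
  have h5 := Real.log_le_log (h0.trans_le h1) h3
  rw [Real.log_mul (by norm_num) h0.ne'] at h5
  have := Real.log_nonneg (show (1 : ℝ) ≤ 2 by norm_num)
  rw [abs_le] at *
  constructor <;> linarith

end Mertens

/-! ### Counting in residue classes and Brun's pure sieve. -/

theorem abs_card_Ioc_filter_modEq_sub_le (U v : ℕ) {M : ℕ} (hM : 0 < M) :
    |(#{u ∈ Ioc 0 U | u ≡ v [MOD M]} : ℝ) - U / M| ≤ 1 := by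
  have h := Nat.Ioc_filter_modEq_card 0 U hM v
  have hM' : (0 : ℚ) < M := by exact_mod_cast hM
  rw [max_eq_left] at h
  · set c := #{u ∈ Ioc 0 U | u ≡ v [MOD M]}
    have hq : |(c : ℚ) - U / M| ≤ 1 := by
      have e : (c : ℚ) = (⌊((U : ℚ) - v) / M⌋ : ℚ) - (⌊(((0 : ℕ) : ℚ) - v) / M⌋ : ℚ) := by
        exact_mod_cast h
      have h1 := Int.floor_le (((U : ℚ) - v) / M)
      have h2 := Int.lt_floor_add_one (((U : ℚ) - v) / M)
      have h3 := Int.floor_le ((((0 : ℕ) : ℚ) - v) / M)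
      have h4 := Int.lt_floor_add_one ((((0 : ℕ) : ℚ) - v) / M)
      have e2 : ((U : ℚ) - v) / M - (((0 : ℕ) : ℚ) - v) / M = U / M := by push_cast; ring
      rw [e, abs_le]
      constructor <;> linarith
    have := (Rat.cast_le (K := ℝ)).2 hq
    push_cast at this
    exact this
  · rw [sub_nonneg]
    apply Int.floor_le_floor
    gcongr
    simp

/-- Quantitative Chinese remainder theorem: the number of `u ≤ U` in prescribed classes. -/
theorem abs_card_filter_residues_sub_le (Ω : (q : ℕ) → Finset (ZMod q)) (U : ℕ) (A : Finset ℕ)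
    (hA : ∀ q ∈ A, q.Prime) (M v : ℕ) (hM : 0 < M) (hMA : ∀ q ∈ A, M.Coprime q) :
    |(#{u ∈ Ioc 0 U | u ≡ v [MOD M] ∧ ∀ q ∈ A, (u : ZMod q) ∈ Ω q} : ℝ)
      - U / M * ∏ q ∈ A, (#(Ω q) / q : ℝ)| ≤ ∏ q ∈ A, (#(Ω q) : ℝ) := by
  induction A using Finset.induction_on generalizing M v with
  | empty => simpa using abs_card_Ioc_filter_modEq_sub_le U v hM
  | insert q A hq ih =>
    have hqp : q.Prime := hA q (mem_insert_self _ _)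
    have : NeZero q := ⟨hqp.ne_zero⟩
    have hMq : M.Coprime q := hMA q (mem_insert_self _ _)
    have hcop : ∀ q' ∈ A, (M * q).Coprime q' := fun q' hq' =>
      Nat.Coprime.mul_left (hMA q' (mem_insert_of_mem hq'))
        ((Nat.coprime_primes hqp (hA q' (mem_insert_of_mem hq'))).2 (by rintro rfl; exact hq hq'))
    have ih' := fun v' => ih (fun q' h => hA q' (mem_insert_of_mem h)) (M * q) v'
      (Nat.mul_pos hM hqp.pos) hcop
    set S := {u ∈ Ioc 0 U | u ≡ v [MOD M] ∧ ∀ q' ∈ insert q A, (u : ZMod q') ∈ Ω q'} with hS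
    have hcard : #S = ∑ w ∈ Ω q, #(S.filter fun u : ℕ => (u : ZMod q) = w) :=
      card_eq_sum_card_fiberwise fun u hu =>
        (mem_filter.1 hu).2.2 q (mem_insert_self _ _)
    -- The classes `v` modulo `M` and `w` modulo `q` merge into one class modulo `M * q`, to which
    -- the induction hypothesis applies; summing over `w` multiplies the error by `#(Ω q)`.
    have hfib : ∀ w ∈ Ω q, |(#(S.filter fun u : ℕ => (u : ZMod q) = w) : ℝ)
        - U / (M * q : ℕ) * ∏ q ∈ A, (#(Ω q) / q : ℝ)| ≤ ∏ q ∈ A, (#(Ω q) : ℝ) := by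
      intro w hw
      obtain ⟨v', hv1, hv2⟩ := Nat.chineseRemainder hMq v w.val
      have : (S.filter fun u : ℕ => (u : ZMod q) = w)
          = {u ∈ Ioc 0 U | u ≡ v' [MOD M * q] ∧ ∀ q ∈ A, (u : ZMod q) ∈ Ω q} := by
        ext u
        have h1 : ((u : ZMod q) = w) ↔ u ≡ v' [MOD q] := by
          rw [← ZMod.natCast_eq_natCast_iff, (ZMod.natCast_eq_natCast_iff _ _ _).2 hv2,
            ZMod.natCast_zmod_val]
        have h2 : u ≡ v [MOD M] ↔ u ≡ v' [MOD M] :=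
          ⟨fun h => h.trans hv1.symm, fun h => h.trans hv1⟩
        simp only [← Nat.modEq_and_modEq_iff_modEq_mul hMq, hS, mem_filter, forall_mem_insert, h2, ← h1]
        constructor
        · rintro ⟨⟨a, b, c, d⟩, e⟩; exact ⟨a, ⟨b, e⟩, d⟩
        · rintro ⟨a, ⟨b, e⟩, d⟩; exact ⟨⟨a, b, e ▸ hw, d⟩, e⟩
      rw [this]
      exact ih' v'
    have hfin : (#S : ℝ) - U / M * ∏ q ∈ insert q A, (#(Ω q) / q : ℝ)
        = ∑ w ∈ Ω q, ((#(S.filter fun u : ℕ => (u : ZMod q) = w) : ℝ)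
          - U / (M * q : ℕ) * ∏ q ∈ A, (#(Ω q) / q : ℝ)) := by
      rw [sum_sub_distrib, hcard, prod_insert hq, sum_const, nsmul_eq_mul]
      push_cast
      ring
    rw [hfin, prod_insert hq, ← nsmul_eq_mul, ← sum_const]
    exact (abs_sum_le_sum_abs _ _).trans (sum_le_sum hfib)

/-- Bonferroni's inequality for an even truncation. -/
theorem ite_eq_empty_le_sum_powerset {S : Finset ℕ} {r : ℕ} (hr : Even r) :
    (if S = ∅ then (1 : ℝ) else 0) ≤ ∑ A ∈ S.powerset with #A ≤ r, (-1) ^ #A := by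
  rw [sum_filter, sum_powerset_apply_card (fun m => if m ≤ r then (-1 : ℝ) ^ m else 0)]
  have e : ∑ m ∈ range (#S + 1), (#S).choose m • (if m ≤ r then (-1 : ℝ) ^ m else 0)
      = ((∑ m ∈ range (r + 1), ((-1) ^ m * (#S).choose m : ℤ) : ℤ) : ℝ) := by
    push_cast
    simp only [nsmul_eq_mul, mul_ite, mul_zero]
    rw [← sum_filter]
    refine sum_subset_zero_on_sdiff (fun m hm => ?_) (fun m hm => ?_) (fun m _ => mul_comm _ _)
    · simp only [mem_filter, mem_range] at hm ⊢; omega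
    · simp only [mem_sdiff, mem_filter, mem_range] at hm
      rw [Nat.choose_eq_zero_of_lt (by omega)]; simp
  rw [e]
  split_ifs with h
  · subst h
    rw [sum_eq_single 0] <;> simp +contextual [Nat.choose_eq_zero_of_lt, Nat.pos_iff_ne_zero]
  -- For nonempty `S` the truncated alternating sum is `(-1) ^ r * (#S - 1).choose r`, nonnegative
  -- for even `r`.
  · obtain ⟨n, hn⟩ : ∃ n, #S = n + 1 := ⟨#S - 1, by have := card_pos.2 (nonempty_iff_ne_empty.2 h); omega⟩
    rw [hn, Int.alternating_sum_range_choose_eq_choose, hr.neg_one_pow]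
    positivity

/-- Brun's pure sieve, as an upper bound. -/
theorem card_sieve_le (Ω : (q : ℕ) → Finset (ZMod q)) (U : ℕ) (P : Finset ℕ)
    (hP : ∀ q ∈ P, q.Prime) {r : ℕ} (hr : Even r) (hrG : 4 * ∑ q ∈ P, (#(Ω q) / q : ℝ) ≤ r)
    {t : ℝ} (ht : 1 ≤ t) (hPt : ∑ q ∈ P, (#(Ω q) : ℝ) ≤ t) :
    (#{u ∈ Ioc 0 U | ∀ q ∈ P, (u : ZMod q) ∉ Ω q} : ℝ)
      ≤ 2 * U * Real.exp (-∑ q ∈ P, (#(Ω q) / q : ℝ)) + Real.exp 1 * t ^ r := by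
  set g : ℕ → ℝ := fun q => #(Ω q) / q with hg
  set G := ∑ q ∈ P, (#(Ω q) / q : ℝ) with hG
  have hg0 : ∀ q, 0 ≤ g q := fun q => div_nonneg (Nat.cast_nonneg _) (Nat.cast_nonneg _)
  have hg1 : ∀ q ∈ P, g q ≤ 1 := by
    intro q hq
    have : NeZero q := ⟨(hP q hq).ne_zero⟩
    have hq0 : (0 : ℝ) < q := by exact_mod_cast (hP q hq).pos
    rw [hg, div_le_one hq0]
    have := card_le_univ (Ω q)
    rw [ZMod.card] at this
    exact_mod_cast this
  set T := {A ∈ P.powerset | #A ≤ r} with hT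
  have step1 : (#{u ∈ Ioc 0 U | ∀ q ∈ P, (u : ZMod q) ∉ Ω q} : ℝ)
      ≤ ∑ A ∈ T, (-1) ^ #A * (#{u ∈ Ioc 0 U | ∀ q ∈ A, (u : ZMod q) ∈ Ω q} : ℝ) := by
    have : ∀ u ∈ Ioc 0 U, (if ∀ q ∈ P, (u : ZMod q) ∉ Ω q then (1 : ℝ) else 0)
        ≤ ∑ A ∈ T, (-1) ^ #A * (if ∀ q ∈ A, (u : ZMod q) ∈ Ω q then (1 : ℝ) else 0) := by
      intro u _
      have h := ite_eq_empty_le_sum_powerset (S := {q ∈ P | (u : ZMod q) ∈ Ω q}) hr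
      have e1 : ({q ∈ P | (u : ZMod q) ∈ Ω q} = ∅) ↔ ∀ q ∈ P, (u : ZMod q) ∉ Ω q :=
        filter_eq_empty_iff
      simp only [e1] at h
      refine h.trans (le_of_eq ?_)
      simp only [mul_ite, mul_one, mul_zero]
      rw [← sum_filter]
      refine sum_congr ?_ fun _ _ => rfl
      ext A
      simp only [hT, mem_filter, mem_powerset, subset_iff]
      constructor
      · rintro ⟨h1, h2⟩
        exact ⟨⟨fun q hq => (h1 hq).1, h2⟩, fun q hq => (h1 hq).2⟩
      · rintro ⟨⟨h1, h2⟩, h3⟩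
        exact ⟨fun q hq => ⟨h1 hq, h3 q hq⟩, h2⟩
    have h := sum_le_sum this
    rw [sum_comm] at h
    simp only [← mul_sum, sum_boole] at h
    exact h
  have step2 : ∀ A ∈ T, (-1 : ℝ) ^ #A * (#{u ∈ Ioc 0 U | ∀ q ∈ A, (u : ZMod q) ∈ Ω q} : ℝ)
      ≤ U * ((-1) ^ #A * ∏ q ∈ A, g q) + ∏ q ∈ A, (#(Ω q) : ℝ) := by
    intro A hA
    have hAP : A ⊆ P := mem_powerset.1 (mem_filter.1 hA).1
    have h := abs_card_filter_residues_sub_le Ω U A (fun q hq => hP q (hAP hq)) 1 0 one_pos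
      (fun q _ => Nat.coprime_one_left q)
    simp only [Nat.modEq_one, true_and, Nat.cast_one, div_one] at h
    rw [abs_le] at h
    rcases neg_one_pow_eq_or ℝ #A with h1 | h1 <;> rw [h1] <;> linarith
  have hexp : ∀ c : ℝ, 0 ≤ c → ∀ f : ℕ → ℝ, (∀ q, 0 ≤ f q) →
      ∏ q ∈ P, (1 + c * f q) ≤ Real.exp (c * ∑ q ∈ P, f q) := by
    intro c hc f hf
    rw [mul_sum, Real.exp_sum]
    refine prod_le_prod (fun q _ => by have := hf q; positivity) fun q _ => ?_
    rw [add_comm]; exact Real.add_one_le_exp _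
  have step3 : ∑ A ∈ T, (-1) ^ #A * ∏ q ∈ A, g q ≤ 2 * Real.exp (-G) := by
    have h1 : ∑ A ∈ P.powerset, (-1) ^ #A * ∏ q ∈ A, g q = ∏ q ∈ P, (1 + -g q) := by
      rw [prod_one_add]
      refine sum_congr rfl fun A _ => ?_
      rw [← prod_const, ← prod_mul_distrib]; simp
    have h2 : ∏ q ∈ P, (1 + -g q) ≤ Real.exp (-G) := by
      rw [hG, ← sum_neg_distrib, Real.exp_sum]
      refine prod_le_prod (fun q hq => by linarith [hg1 q hq]) fun q _ => ?_
      rw [add_comm]; exact Real.add_one_le_exp _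
    have h3 : -∑ A ∈ P.powerset with ¬ #A ≤ r, (-1) ^ #A * ∏ q ∈ A, g q ≤ Real.exp (-G) := by
      rw [← sum_neg_distrib]
      -- Rankin's trick: the weight `exp (#A - r) ≥ 1` bounds the tail by `exp (-r + e * G)`, which
      -- is at most `exp (-G)` because `r ≥ 4 * G` and `e < 3`.
      have : ∀ A ∈ P.powerset, -((-1) ^ #A * ∏ q ∈ A, g q) ≤ if ¬ #A ≤ r then
          Real.exp (-r) * ∏ q ∈ A, (Real.exp 1 * g q) else -((-1) ^ #A * ∏ q ∈ A, g q) := by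
        intro A _
        split_ifs with h
        · exact le_rfl
        · have hp : 0 ≤ ∏ q ∈ A, g q := prod_nonneg fun q _ => hg0 q
          rw [prod_mul_distrib, prod_const, ← mul_assoc, ← Real.exp_nat_mul, mul_one, ← Real.exp_add]
          have : 1 ≤ Real.exp (-(r : ℝ) + (#A : ℝ)) := by
            rw [Real.one_le_exp_iff]
            have : (r : ℝ) ≤ #A := by exact_mod_cast (by omega : r ≤ #A)
            linarith
          rcases neg_one_pow_eq_or ℝ #A with h1 | h1 <;> rw [h1] <;> nlinarith
      calc ∑ A ∈ P.powerset with ¬ #A ≤ r, -((-1) ^ #A * ∏ q ∈ A, g q)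
          ≤ ∑ A ∈ P.powerset with ¬ #A ≤ r, Real.exp (-r) * ∏ q ∈ A, (Real.exp 1 * g q) := by
            refine sum_le_sum fun A hA => ?_
            have h := this A (mem_filter.1 hA).1
            rwa [if_pos (mem_filter.1 hA).2] at h
        _ ≤ ∑ A ∈ P.powerset, Real.exp (-r) * ∏ q ∈ A, (Real.exp 1 * g q) :=
            sum_le_sum_of_subset_of_nonneg (filter_subset _ _) fun A _ _ =>
              mul_nonneg (Real.exp_pos _).le
                (prod_nonneg fun q _ => mul_nonneg (Real.exp_pos _).le (hg0 q))
        _ = Real.exp (-r) * ∏ q ∈ P, (1 + Real.exp 1 * g q) := by rw [← mul_sum, prod_one_add]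
        _ ≤ Real.exp (-r) * Real.exp (Real.exp 1 * G) := by
            gcongr; exact hexp _ (Real.exp_pos _).le g hg0
        _ = Real.exp (-r + Real.exp 1 * G) := by rw [Real.exp_add]
        _ ≤ Real.exp (-G) := by
            rw [Real.exp_le_exp]
            have : 0 ≤ G := sum_nonneg fun q _ => hg0 q
            nlinarith [Real.exp_one_lt_d9]
    have h4 := sum_filter_add_sum_filter_not P.powerset (fun A => #A ≤ r)
      (fun A => (-1 : ℝ) ^ #A * ∏ q ∈ A, g q)
    linarith
  have ht0 : 0 < t := one_pos.trans_le ht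
  have hρ : ∀ q, 0 ≤ t⁻¹ * (#(Ω q) : ℝ) := fun q =>
    mul_nonneg (inv_nonneg.2 ht0.le) (Nat.cast_nonneg _)
  -- Rankin's trick again, with weight `t ^ (r - #A) ≥ 1`; the full product is then at most `e`
  -- since the `#(Ω q)` sum to at most `t`.
  have step4 : ∑ A ∈ T, ∏ q ∈ A, (#(Ω q) : ℝ) ≤ Real.exp 1 * t ^ r := by
    calc ∑ A ∈ T, ∏ q ∈ A, (#(Ω q) : ℝ) ≤ ∑ A ∈ T, t ^ r * ∏ q ∈ A, (t⁻¹ * (#(Ω q) : ℝ)) := by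
          refine sum_le_sum fun A hA => ?_
          rw [prod_mul_distrib, prod_const, ← mul_assoc]
          have : 1 ≤ t ^ r * t⁻¹ ^ #A := by
            rw [inv_pow, ← div_eq_mul_inv, one_le_div (pow_pos ht0 _)]
            exact pow_le_pow_right₀ ht (mem_filter.1 hA).2
          exact le_mul_of_one_le_left (prod_nonneg fun q _ => Nat.cast_nonneg _) this
      _ ≤ ∑ A ∈ P.powerset, t ^ r * ∏ q ∈ A, (t⁻¹ * (#(Ω q) : ℝ)) :=
          sum_le_sum_of_subset_of_nonneg (filter_subset _ _) fun A _ _ =>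
            mul_nonneg (pow_nonneg ht0.le _) (prod_nonneg fun q _ => hρ q)
      _ = t ^ r * ∏ q ∈ P, (1 + t⁻¹ * (#(Ω q) : ℝ)) := by rw [← mul_sum, prod_one_add]
      _ ≤ t ^ r * Real.exp (t⁻¹ * ∑ q ∈ P, (#(Ω q) : ℝ)) := by
          gcongr
          exact hexp _ (inv_nonneg.2 ht0.le) (fun q => (#(Ω q) : ℝ)) fun q => Nat.cast_nonneg _
      _ ≤ t ^ r * Real.exp 1 := by
          gcongr
          rw [inv_mul_le_iff₀ ht0]; linarith
      _ = _ := mul_comm _ _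
  calc _ ≤ _ := step1
    _ ≤ _ := sum_le_sum step2
    _ = U * ∑ A ∈ T, (-1) ^ #A * ∏ q ∈ A, g q + ∑ A ∈ T, ∏ q ∈ A, (#(Ω q) : ℝ) := by
        rw [sum_add_distrib, ← mul_sum]
    _ ≤ U * (2 * Real.exp (-G)) + Real.exp 1 * t ^ r := by gcongr
    _ = _ := by ring

/-! ### Primitive representations as a sum of two squares: counting, and division by a prime. -/

/-- In `(ac + bd)² + (ad - bc)² = m²` a vanishing determinant forces `ac + bd = ±m`, the equality
case of Cauchy–Schwarz. -/
theorem eq_or_eq_neg_of_mul_eq_mul {a b c d m : ℤ} (h1 : a ^ 2 + b ^ 2 = m) (h2 : c ^ 2 + d ^ 2 = m)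
    (h : a * d = b * c) : (a = c ∧ b = d) ∨ (a = -c ∧ b = -d) := by
  have h3 : (a * c + b * d) ^ 2 = m ^ 2 := by
    have : (a * c + b * d) ^ 2 + (a * d - b * c) ^ 2 = (a ^ 2 + b ^ 2) * (c ^ 2 + d ^ 2) := by ring
    rw [h1, h2, h] at this
    linarith
  rcases sq_eq_sq_iff_eq_or_eq_neg.1 h3 with h4 | h4
  · left
    have h5 : (a - c) ^ 2 + (b - d) ^ 2 = 0 := by linarith
    have h6 : (a - c) ^ 2 = 0 := by nlinarith [sq_nonneg (a - c), sq_nonneg (b - d)]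
    have h7 : (b - d) ^ 2 = 0 := by nlinarith [sq_nonneg (a - c), sq_nonneg (b - d)]
    exact ⟨sub_eq_zero.1 (pow_eq_zero_iff two_ne_zero |>.1 h6),
      sub_eq_zero.1 (pow_eq_zero_iff two_ne_zero |>.1 h7)⟩
  · right
    have h5 : (a + c) ^ 2 + (b + d) ^ 2 = 0 := by linarith
    have h6 : (a + c) ^ 2 = 0 := by nlinarith [sq_nonneg (a + c), sq_nonneg (b + d)]
    have h7 : (b + d) ^ 2 = 0 := by nlinarith [sq_nonneg (a + c), sq_nonneg (b + d)]
    exact ⟨eq_neg_of_add_eq_zero_left (pow_eq_zero_iff two_ne_zero |>.1 h6),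
      eq_neg_of_add_eq_zero_left (pow_eq_zero_iff two_ne_zero |>.1 h7)⟩

/-- All primitive representations of `m` as a sum of two squares of integers. -/
noncomputable def primReps (m : ℕ) : Finset (ℤ × ℤ) :=
  open Classical in
  (Icc (-(m : ℤ)) m ×ˢ Icc (-(m : ℤ)) m).filter
    fun t => t.1 ^ 2 + t.2 ^ 2 = m ∧ IsCoprime t.1 t.2

theorem mem_primReps {m : ℕ} {t : ℤ × ℤ} :
    t ∈ primReps m ↔ t.1 ^ 2 + t.2 ^ 2 = m ∧ IsCoprime t.1 t.2 := by
  simp only [primReps, mem_filter, mem_product, mem_Icc, and_iff_right_iff_imp]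
  rintro ⟨h, -⟩
  have key : ∀ x y : ℤ, x ^ 2 + y ^ 2 = m → -(m : ℤ) ≤ x ∧ x ≤ m := by
    intro x y h
    have h1 : x ≤ x ^ 2 := Int.le_self_sq x
    have h2 : -x ≤ (-x) ^ 2 := Int.le_self_sq (-x)
    constructor <;> nlinarith [sq_nonneg y]
  exact ⟨key _ _ h, key t.2 t.1 (by linarith)⟩

/-- The square roots of `-1` modulo `m`. -/
noncomputable def sqrtNegOne (m : ℕ) [NeZero m] : Finset (ZMod m) :=
  open Classical in univ.filter fun t => t ^ 2 = -1

theorem mem_sqrtNegOne {m : ℕ} [NeZero m] {t : ZMod m} : t ∈ sqrtNegOne m ↔ t ^ 2 = -1 := by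
  simp [sqrtNegOne]

theorem omegaStar_mul_of_coprime {a b : ℕ} (h : a.Coprime b) :
    omegaStar (a * b) = omegaStar a + omegaStar b := by
  rw [omegaStar, h.primeFactors_mul, filter_union, card_union_of_disjoint]
  · rfl
  · exact disjoint_filter_filter h.disjoint_primeFactors

theorem card_sqrtNegOne_mul_le {a b : ℕ} [NeZero a] [NeZero b] [NeZero (a * b)]
    (h : a.Coprime b) : #(sqrtNegOne (a * b)) ≤ #(sqrtNegOne a) * #(sqrtNegOne b) := by
  classical
  rw [← card_product]
  let e := ZMod.chineseRemainder h
  refine card_le_card_of_injOn (fun t => e t) (fun t ht => ?_) (e.injective.injOn)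
  have ht := mem_sqrtNegOne.1 (mem_coe.1 ht)
  have h2 : (e t) ^ 2 = -1 := by rw [← map_pow, ht, map_neg, map_one]
  rw [mem_coe, mem_product, mem_sqrtNegOne, mem_sqrtNegOne]
  exact ⟨congrArg Prod.fst h2, congrArg Prod.snd h2⟩

theorem not_isSquare_neg_one_zmod_four : ¬ IsSquare (-1 : ZMod 4) := by decide

/-- For odd `p`, two roots satisfy `(t - s)(t + s) = 0`. If both factors were non-units, `p` would
divide `2s`, hence `s`, against `s ^ 2 = -1`. For `p = 2` there is no root once 4 divides the
modulus. -/
theorem card_sqrtNegOne_prime_pow_le {p e : ℕ} (hp : p.Prime) (he : 0 < e) [NeZero (p ^ e)] :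
    #(sqrtNegOne (p ^ e)) ≤ 2 ^ omegaStar (p ^ e) := by
  classical
  have hpf : (p ^ e).primeFactors = {p} := Nat.primeFactors_prime_pow he.ne' hp
  rcases hp.eq_two_or_odd' with rfl | hodd
  · have h0 : omegaStar (2 ^ e) = 0 := by
      rw [omegaStar, hpf]; simp [filter_singleton]
    rw [h0, pow_zero]
    obtain rfl | he2 : e = 1 ∨ 2 ≤ e := by omega
    · rw [card_le_one]
      intro a ha b hb
      have ha := mem_sqrtNegOne.1 ha
      have hb := mem_sqrtNegOne.1 hb
      have : ∀ a b : ZMod (2 ^ 1), a ^ 2 = -1 → b ^ 2 = -1 → a = b := by decide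
      exact this a b ha hb
    · rw [Nat.le_one_iff_eq_zero_or_eq_one, card_eq_zero]
      left
      rw [eq_empty_iff_forall_notMem]
      intro t ht
      have ht := mem_sqrtNegOne.1 ht
      exact not_isSquare_neg_one_zmod_four (ZMod.isSquare_neg_one_of_dvd
        (pow_dvd_pow 2 he2) ⟨t, by rw [← ht, sq]⟩)
  · have h1 : omegaStar (p ^ e) = 1 := by
      rw [omegaStar, hpf, filter_singleton, if_pos hodd, card_singleton]
    rw [h1, pow_one]
    rcases (sqrtNegOne (p ^ e)).eq_empty_or_nonempty with h | ⟨s, hs⟩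
    · simp [h]
    have hs := mem_sqrtNegOne.1 hs
    refine (card_le_card (t := {s, -s}) fun t ht => ?_).trans card_le_two
    have ht := mem_sqrtNegOne.1 ht
    have hmul : (t - s) * (t + s) = 0 := by linear_combination ht - hs
    have hcases : ∀ x y : ZMod (p ^ e), x * y = 0 → x = 0 ∨ y = 0 ∨
        (¬ IsUnit x ∧ ¬ IsUnit y) := by
      intro x y hxy
      by_cases hx : IsUnit x
      · right; left; exact (hx.mul_right_eq_zero).1 hxy
      by_cases hy : IsUnit y
      · left; exact (hy.mul_left_eq_zero).1 hxy
      exact Or.inr (Or.inr ⟨hx, hy⟩)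
    have hloc : ∀ x : ZMod (p ^ e), ¬ IsUnit x → ((ZMod.castHom (dvd_pow_self p he.ne') (ZMod p)) x) = 0 := by
      intro x hx
      rw [← ZMod.natCast_zmod_val x, ZMod.isUnit_iff_coprime] at hx
      have h3 : p ∣ x.val := by
        by_contra h
        exact hx (((Nat.Prime.coprime_iff_not_dvd hp).2 h).symm.pow_right e)
      rw [← ZMod.natCast_zmod_val x, map_natCast]
      exact (ZMod.natCast_eq_zero_iff _ _).2 h3
    rcases hcases _ _ hmul with h | h | ⟨h, h'⟩
    · simp [sub_eq_zero.1 h]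
    · simp [eq_neg_of_add_eq_zero_left h]
    · exfalso
      have : Fact p.Prime := ⟨hp⟩
      have e1 := hloc _ h
      have e2 := hloc _ h'
      rw [map_sub] at e1
      rw [map_add] at e2
      set φ := ZMod.castHom (dvd_pow_self p he.ne') (ZMod p)
      have e3 : 2 * φ s = 0 := by linear_combination e2 - e1
      have e4 : (φ s) ^ 2 = -1 := by rw [← map_pow, hs, map_neg, map_one]
      have h2 : (2 : ZMod p) ≠ 0 := by
        intro h2
        have : p ∣ 2 := (ZMod.natCast_eq_zero_iff 2 p).1 (by exact_mod_cast h2)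
        have := (Nat.prime_dvd_prime_iff_eq hp Nat.prime_two).1 this
        subst this; exact absurd hodd (by decide)
      have e5 : φ s = 0 := (mul_eq_zero.1 e3).resolve_left h2
      rw [e5] at e4
      have : (1 : ZMod p) = 0 := by linear_combination e4
      exact one_ne_zero this

theorem card_sqrtNegOne_le (m : ℕ) [hm : NeZero m] : #(sqrtNegOne m) ≤ 2 ^ omegaStar m := by
  revert hm
  induction m using Nat.recOnPosPrimePosCoprime with
  | zero => intro hm; exact absurd rfl hm.out
  | one =>
    intro hm
    refine (card_le_univ _).trans ?_
    rw [ZMod.card]; exact Nat.one_le_two_pow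
  | prime_pow p n hp hn => intro hm; exact card_sqrtNegOne_prime_pow_le hp hn
  | coprime a b ha hb hab iha ihb =>
    intro hm
    have : NeZero a := ⟨by omega⟩
    have : NeZero b := ⟨by omega⟩
    rw [omegaStar_mul_of_coprime hab, pow_add]
    exact (card_sqrtNegOne_mul_le hab).trans (Nat.mul_le_mul iha ihb)

/-- The ratio of the coordinates modulo `m` is a square root of `-1`. Two representations with equal
ratio have determinant `m * j`, and determinant² + scalar product² = `m ^ 2` forces `j ∈ {0, 1,
-1}`. So they differ by one of the four Gaussian units. -/
theorem card_primReps_le (m : ℕ) (hm : m ≠ 0) : #(primReps m) ≤ 4 * 2 ^ omegaStar m := by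
  classical
  have : NeZero m := ⟨hm⟩
  have hunit : ∀ t ∈ primReps m, IsUnit (t.2 : ZMod m) := by
    intro t ht
    obtain ⟨h1, x, y, hxy⟩ := mem_primReps.1 ht
    have h2 : IsCoprime (t.2 ^ 2) (t.1 ^ 2) := (IsCoprime.pow ⟨y, x, by linarith⟩)
    have h3 : IsCoprime (t.2 ^ 2) (m : ℤ) := by
      rw [← h1]
      have := h2.add_mul_left_right 1
      simpa using this
    obtain ⟨a, b, hab⟩ := (IsCoprime.pow_left_iff two_pos).1 h3
    refine IsUnit.of_mul_eq_one_right (a : ZMod m) ?_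
    have := congrArg (Int.cast : ℤ → ZMod m) hab
    simpa using this
  let φ : ℤ × ℤ → ZMod m := fun t => (t.1 : ZMod m) * (t.2 : ZMod m)⁻¹
  have hφ : ∀ t ∈ primReps m, φ t * t.2 = t.1 := by
    intro t ht
    simp only [φ]
    rw [mul_assoc, ZMod.inv_mul_of_unit _ (hunit t ht), mul_one]
  have himg : (primReps m).image φ ⊆ sqrtNegOne m := by
    intro w hw
    obtain ⟨t, ht, rfl⟩ := mem_image.1 hw
    rw [mem_sqrtNegOne]
    have h1 := congrArg (Int.cast : ℤ → ZMod m) (mem_primReps.1 ht).1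
    push_cast at h1
    rw [ZMod.natCast_self, ← hφ t ht] at h1
    have h2 : (φ t ^ 2 + 1) * (t.2 : ZMod m) ^ 2 = 0 := by linear_combination h1
    have h3 := (((hunit t ht).pow 2).mul_left_eq_zero).1 h2
    exact eq_neg_of_add_eq_zero_left h3
  have hfib : ∀ w ∈ (primReps m).image φ, #{t ∈ primReps m | φ t = w} ≤ 4 := by
    intro w hw
    obtain ⟨s, hs, rfl⟩ := mem_image.1 hw
    refine (card_le_card (t := {s, (-s.1, -s.2), (s.2, -s.1), (-s.2, s.1)}) ?_).trans card_le_four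
    intro t ht
    obtain ⟨ht, hts⟩ := mem_filter.1 ht
    have hs1 := (mem_primReps.1 hs).1
    have ht1 := (mem_primReps.1 ht).1
    have hdvd : (m : ℤ) ∣ t.1 * s.2 - t.2 * s.1 := by
      rw [← ZMod.intCast_zmod_eq_zero_iff_dvd]
      push_cast
      rw [← hφ t ht, ← hφ s hs, hts]; ring
    obtain ⟨j, hj⟩ := hdvd
    have hm0 : (0 : ℤ) < m := by exact_mod_cast Nat.pos_of_ne_zero hm
    have hid : (t.1 * s.2 - t.2 * s.1) ^ 2 + (t.1 * s.1 + t.2 * s.2) ^ 2 = (m : ℤ) ^ 2 := by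
      have : (t.1 * s.2 - t.2 * s.1) ^ 2 + (t.1 * s.1 + t.2 * s.2) ^ 2
        = (t.1 ^ 2 + t.2 ^ 2) * (s.1 ^ 2 + s.2 ^ 2) := by ring
      rw [this, hs1, ht1]; ring
    have hj1 : j ^ 2 ≤ 1 := by
      have : (m : ℤ) ^ 2 * j ^ 2 ≤ (m : ℤ) ^ 2 * 1 := by
        rw [hj] at hid; nlinarith [sq_nonneg (t.1 * s.1 + t.2 * s.2)]
      exact le_of_mul_le_mul_left this (by positivity)
    have hj2 : j = 0 ∨ j ^ 2 = 1 := by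
      by_cases h : j = 0
      · exact Or.inl h
      · right
        have : 0 < j ^ 2 := by positivity
        omega
    simp only [mem_insert, mem_singleton, Prod.ext_iff]
    rcases hj2 with h | h
    · rw [h, mul_zero] at hj
      rcases eq_or_eq_neg_of_mul_eq_mul ht1 hs1 (by linarith) with ⟨a, b⟩ | ⟨a, b⟩ <;> simp [a, b]
    · have h0 : (t.1 * s.1 + t.2 * s.2) ^ 2 = 0 := by
        rw [hj] at hid
        have : (m * j) ^ 2 = (m : ℤ) ^ 2 := by rw [mul_pow, h, mul_one]
        linarith
      have h0 := (pow_eq_zero_iff two_ne_zero).1 h0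
      rcases eq_or_eq_neg_of_mul_eq_mul ht1 (show s.2 ^ 2 + (-s.1) ^ 2 = m by linarith)
        (by linarith) with ⟨a, b⟩ | ⟨a, b⟩ <;> simp [a, b]
  exact (card_le_mul_card_image _ 4 hfib).trans
    (Nat.mul_le_mul_left 4 ((card_le_card himg).trans (card_sqrtNegOne_le m)))

/-- Gaussian division: `a + ib = (c + id)(u + iw)` with `w = v` or `w = -v`, depending on which
conjugate factor of `p` divides `a + ib`. The case `w = -v` is brought to the same shape by changing
the sign of `c`. -/
theorem exists_mem_primReps_of_mul_prime {m p a b u v : ℕ} (hp : p.Prime) (huv : u ^ 2 + v ^ 2 = p)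
    (hab : a ^ 2 + b ^ 2 = m * p) (hc : Nat.gcd a b = 1) :
    ∃ t ∈ primReps m, (t.1 * v + t.2 * u).natAbs = b := by
  have hpZ : Prime (p : ℤ) := Nat.prime_iff_prime_int.1 hp
  have hp0 : (p : ℤ) ≠ 0 := hpZ.ne_zero
  have h1 : (u : ℤ) ^ 2 + (v : ℤ) ^ 2 = p := by exact_mod_cast huv
  have h2 : (a : ℤ) ^ 2 + (b : ℤ) ^ 2 = m * p := by exact_mod_cast hab
  obtain ⟨x, y, hxy⟩ : IsCoprime (a : ℤ) b := Nat.isCoprime_iff_coprime.2 hc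
  have main : ∀ w : ℤ, w ^ 2 = (v : ℤ) ^ 2 → (p : ℤ) ∣ a * u + b * w →
      ∃ t ∈ primReps m, t.1 * w + t.2 * u = b := by
    intro w hw ⟨c, hcc⟩
    have hd2 : (p : ℤ) ∣ (b * u - a * w) ^ 2 := by
      refine ⟨m * p - p * c ^ 2, ?_⟩
      have : (b * u - a * w : ℤ) ^ 2 = (a ^ 2 + b ^ 2) * (u ^ 2 + w ^ 2) - (a * u + b * w) ^ 2 := by
        ring
      rw [this, hw, h1, h2, hcc]; ring
    obtain ⟨d, hd⟩ := hpZ.dvd_of_dvd_pow hd2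
    have hb : c * w + d * u = b := by
      apply mul_left_cancel₀ hp0
      have : (p : ℤ) * (c * w + d * u) = (p * c) * w + (p * d) * u := by ring
      rw [this, ← hcc, ← hd]
      linear_combination (b : ℤ) * hw + b * h1
    have ha : c * u - d * w = a := by
      apply mul_left_cancel₀ hp0
      have : (p : ℤ) * (c * u - d * w) = (p * c) * u - (p * d) * w := by ring
      rw [this, ← hcc, ← hd]
      linear_combination (a : ℤ) * hw + a * h1
    refine ⟨(c, d), mem_primReps.2 ⟨?_, ⟨x * u + y * w, y * u - x * w, ?_⟩⟩, hb⟩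
    · apply mul_left_cancel₀ hp0
      have : (p : ℤ) * (c ^ 2 + d ^ 2) = (u ^ 2 + w ^ 2) * (c ^ 2 + d ^ 2) := by rw [hw, h1]
      rw [this]
      have : ((u : ℤ) ^ 2 + w ^ 2) * (c ^ 2 + d ^ 2) = (c * u - d * w) ^ 2 + (c * w + d * u) ^ 2 := by
        ring
      rw [this, ha, hb, h2]; ring
    · have : (x * u + y * w) * c + (y * u - x * w) * d = x * (c * u - d * w) + y * (c * w + d * u) := by
        ring
      simp only
      rw [this, ha, hb, hxy]
  -- Modulo `p` both `a ^ 2 + b ^ 2` and `u ^ 2 + v ^ 2` vanish, hence so does `(a * u) ^ 2 - (b *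
  -- v) ^ 2`; the prime then selects the sign of `w`.
  have hdvd : (p : ℤ) ∣ (a * u + b * v) * (a * u + b * (-v)) := by
    refine ⟨m * u ^ 2 - b ^ 2, ?_⟩
    linear_combination (u : ℤ) ^ 2 * h2 - (b : ℤ) ^ 2 * h1
  rcases hpZ.dvd_or_dvd hdvd with h | h
  · obtain ⟨t, ht, hb⟩ := main v rfl h
    exact ⟨t, ht, by rw [hb]; simp⟩
  · obtain ⟨t, ht, hb⟩ := main (-v) (by ring) h
    obtain ⟨ht1, ht2⟩ := mem_primReps.1 ht
    refine ⟨(-t.1, t.2), mem_primReps.2 ⟨by simpa using ht1, ht2.neg_left⟩, ?_⟩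
    have : -t.1 * (v : ℤ) + t.2 * u = b := by linarith
    simp only [this]; simp

/-- A primitive representation of `b` makes `-1` a square modulo every divisor of `b`. The sieve
uses no other property of `R'`. -/
theorem not_dvd_of_mem_R' {b q : ℕ} (hb : b ∈ R') (hq : q.Prime) (hq4 : q % 4 = 3) : ¬ q ∣ b := by
  intro hdvd
  have h := hb.2
  rw [r0Star, repStar] at h
  obtain ⟨⟨a, c⟩, hac⟩ := (Set.ncard_pos (repStar_finite _ b)).1 h
  have hs := ZMod.isSquare_neg_one_of_eq_sq_add_sq_of_coprime hac.2.1.symm hac.2.2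
  exact Nat.mod_four_ne_three_of_mem_primeFactors_of_isSquare_neg_one
    hq.mem_primeFactors_self (ZMod.isSquare_neg_one_of_dvd hdvd hs) hq4

theorem isSquare_neg_one_of_repStar_pos {S : Set ℕ} {n : ℕ} (h : 0 < repStar S n) :
    IsSquare (-1 : ZMod n) := by
  obtain ⟨⟨a, c⟩, hac⟩ := (Set.ncard_pos (repStar_finite _ n)).1 h
  exact ZMod.isSquare_neg_one_of_eq_sq_add_sq_of_coprime hac.2.1.symm hac.2.2

theorem repStar_le (S : Set ℕ) {n : ℕ} (hn : n ≠ 0) : repStar S n ≤ 4 * 2 ^ omegaStar n := by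
  refine le_trans ?_ (card_primReps_le n hn)
  rw [← Set.ncard_coe_finset]
  refine Set.ncard_le_ncard_of_injOn (fun ab => ((ab.1 : ℤ), (ab.2 : ℤ))) (fun ab hab => ?_) ?_
    (finite_toSet _)
  · rw [mem_coe, mem_primReps]
    exact ⟨by have := hab.2.1; dsimp only; exact_mod_cast this, Nat.isCoprime_iff_coprime.2 hab.2.2⟩
  · rintro ⟨a, b⟩ - ⟨c, d⟩ - h
    simpa using h

open Classical in
/-- The `ℓ`-element sets of pairwise non-proportional primitive representations of `m`. -/
noncomputable def repFamilies (m ℓ : ℕ) : Finset (Finset (ℤ × ℤ)) :=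
  (powersetCard ℓ (primReps m)).filter
    fun T => ∀ s ∈ T, ∀ t ∈ T, s ≠ t → s.1 * t.2 - s.2 * t.1 ≠ 0

-- A representation `(a, b)` is determined by `b`, and `b` is recovered from the `t` attached to it,
-- so distinct representations give distinct `t`. Proportional `t` agree up to sign and would give
-- the same `b`, so the `t` are pairwise non-proportional.
open Classical in
theorem choose_repStar_le {m p u v : ℕ} (S : Set ℕ) (hp : p.Prime) (huv : u ^ 2 + v ^ 2 = p) (ℓ : ℕ) :
    (repStar S (m * p)).choose ℓ
      ≤ #{T ∈ repFamilies m ℓ | ∀ t ∈ T, (t.1 * (v : ℤ) + t.2 * (u : ℤ)).natAbs ∈ S} := by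
  set F := (repStar_finite S (m * p)).toFinset with hF
  have hcard : repStar S (m * p) = #F := by
    rw [repStar, Set.ncard_eq_toFinset_card _ (repStar_finite S (m * p))]
  have hmem : ∀ ab ∈ F, ∃ t ∈ primReps m, (t.1 * v + t.2 * u).natAbs = ab.2 := by
    intro ab hab
    have hab := (Set.Finite.mem_toFinset _).1 hab
    exact exists_mem_primReps_of_mul_prime hp huv hab.2.1 hab.2.2
  choose! h hh1 hh2 using hmem
  have hinj : ∀ ab ∈ F, ∀ cd ∈ F, (ab.2 = cd.2) → ab = cd := by
    intro ab hab cd hcd h2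
    have hab := (Set.Finite.mem_toFinset _).1 hab
    have hcd := (Set.Finite.mem_toFinset _).1 hcd
    have h1 : ab.1 ^ 2 = cd.1 ^ 2 := by
      have e1 := hab.2.1
      have e2 := hcd.2.1
      rw [h2] at e1
      omega
    exact Prod.ext (Nat.pow_left_injective two_ne_zero h1) h2
  have hcard' : #(F.image h) = #F := card_image_of_injOn fun ab hab cd hcd e =>
    hinj ab hab cd hcd (by rw [← hh2 ab hab, ← hh2 cd hcd, e])
  rw [hcard, ← hcard', ← card_powersetCard]
  refine card_le_card fun T hT => ?_
  obtain ⟨hT1, hT2⟩ := mem_powersetCard.1 hT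
  have hT3 : ∀ t ∈ T, ∃ ab ∈ F, h ab = t := fun t ht => mem_image.1 (hT1 ht)
  rw [mem_filter, repFamilies, mem_filter, mem_powersetCard]
  refine ⟨⟨⟨fun t ht => ?_, hT2⟩, fun s hs t ht hst h0 => hst ?_⟩, fun t ht => ?_⟩
  · obtain ⟨ab, hab, rfl⟩ := hT3 t ht
    exact hh1 ab hab
  · obtain ⟨ab, hab, rfl⟩ := hT3 s hs
    obtain ⟨cd, hcd, rfl⟩ := hT3 t ht
    congr 1
    refine hinj ab hab cd hcd ?_
    rw [← hh2 ab hab, ← hh2 cd hcd]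
    rcases eq_or_eq_neg_of_mul_eq_mul (mem_primReps.1 (hh1 ab hab)).1
      (mem_primReps.1 (hh1 cd hcd)).1 (by linarith) with ⟨a, b⟩ | ⟨a, b⟩
    · rw [a, b]
    · rw [a, b, ← Int.natAbs_neg]; congr 1; ring
  · obtain ⟨ab, hab, rfl⟩ := hT3 t ht
    rw [hh2 ab hab]
    exact ((Set.Finite.mem_toFinset _).1 hab).1

theorem card_repFamilies_le (m ℓ : ℕ) (hm : m ≠ 0) :
    #(repFamilies m ℓ) ≤ (4 * 2 ^ omegaStar m) ^ ℓ := by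
  refine (card_filter_le _ _).trans ?_
  rw [card_powersetCard]
  exact (Nat.choose_le_pow _ _).trans (Nat.pow_le_pow_left (card_primReps_le m hm) ℓ)

/-! ### Sieving the linear forms attached to a family of representations. -/

/-- At most `log D` primes above `e` divide `D`, because their product does. -/
theorem sum_inv_prime_dvd_le {D : ℕ} (hD : D ≠ 0) {w : ℝ} (hw : Real.exp 1 ≤ w) (N : ℕ) :
    ∑ q ∈ Ioc 0 N with Nat.Prime q ∧ w < (q : ℝ) ∧ q ∣ D, (1 / q : ℝ) ≤ Real.log D / w := by
  set S := {q ∈ Ioc 0 N | Nat.Prime q ∧ w < (q : ℝ) ∧ q ∣ D} with hS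
  have hw0 : 0 < w := (Real.exp_pos 1).trans_le hw
  have hprod : ∏ q ∈ S, q ∣ D := prod_primes_dvd D
    (fun q hq => (mem_filter.1 hq).2.1.prime) fun q hq => (mem_filter.1 hq).2.2.2
  have hcard : (#S : ℝ) ≤ Real.log D := by
    rw [Real.le_log_iff_exp_le (by exact_mod_cast Nat.pos_of_ne_zero hD)]
    calc Real.exp #S = ∏ q ∈ S, Real.exp 1 := by rw [prod_const, ← Real.exp_nat_mul, mul_one]
      _ ≤ ∏ q ∈ S, (q : ℝ) := prod_le_prod (fun _ _ => (Real.exp_pos 1).le)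
          fun q hq => hw.trans (mem_filter.1 hq).2.2.1.le
      _ = ((∏ q ∈ S, q : ℕ) : ℝ) := by push_cast; rfl
      _ ≤ D := by exact_mod_cast Nat.le_of_dvd (Nat.pos_of_ne_zero hD) hprod
  calc ∑ q ∈ S, (1 / q : ℝ) ≤ ∑ q ∈ S, 1 / w := sum_le_sum fun q hq =>
        one_div_le_one_div_of_le hw0 (mem_filter.1 hq).2.2.1.le
    _ = #S / w := by rw [sum_const, nsmul_eq_mul]; ring
    _ ≤ _ := by gcongr

theorem exists_le_sum_inv_prime_not_dvd :
    ∃ B : ℝ, 0 ≤ B ∧ ∀ a : ℕ, (a = 1 ∨ a = 3) → ∀ z w : ℝ, 2 ≤ z → Real.exp 1 ≤ w →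
      ∀ D : ℕ, D ≠ 0 →
      (Real.log (Real.log z) - Real.log (Real.log w)) / 2 - B - Real.log D / w
        ≤ ∑ q ∈ Ioc 0 ⌊z⌋₊ with (Nat.Prime q ∧ q % 4 = a) ∧ w < (q : ℝ) ∧ ¬ q ∣ D, (1 / q : ℝ) := by
  obtain ⟨B, hB⟩ := exists_abs_sum_inv_prime_mod_four_le
  refine ⟨2 * B, by linarith [(abs_nonneg _).trans (hB 1 (Or.inl rfl) 2 le_rfl)],
    fun a ha z w hz hw D hD => ?_⟩
  have hw2 : 2 ≤ w := by linarith [Real.exp_one_gt_d9]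
  have h1 := hB a ha z hz
  have h2 := hB a ha w hw2
  have h3 := sum_inv_prime_dvd_le hD hw ⌊z⌋₊
  set S₁ := {q ∈ Ioc 0 ⌊z⌋₊ | Nat.Prime q ∧ q % 4 = a}
  set S₂ := {q ∈ Ioc 0 ⌊w⌋₊ | Nat.Prime q ∧ q % 4 = a}
  set S₃ := {q ∈ Ioc 0 ⌊z⌋₊ | Nat.Prime q ∧ w < (q : ℝ) ∧ q ∣ D}
  set S₄ := {q ∈ Ioc 0 ⌊z⌋₊ | (Nat.Prime q ∧ q % 4 = a) ∧ w < (q : ℝ) ∧ ¬ q ∣ D}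
  have hsub : S₁ ⊆ S₂ ∪ S₃ ∪ S₄ := by
    intro q hq
    simp only [S₁, S₂, S₃, S₄, mem_union, mem_filter, mem_Ioc] at hq ⊢
    by_cases hqw : w < q
    · by_cases hqD : q ∣ D <;> tauto
    · left; left
      exact ⟨⟨hq.1.1, Nat.le_floor (not_lt.1 hqw)⟩, hq.2⟩
  have h0 : ∀ q : ℕ, 0 ≤ (1 / q : ℝ) := fun q => by positivity
  have h4 : ∑ q ∈ S₁, (1 / q : ℝ)
      ≤ ∑ q ∈ S₂, (1 / q : ℝ) + ∑ q ∈ S₃, (1 / q : ℝ) + ∑ q ∈ S₄, (1 / q : ℝ) := by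
    refine (sum_le_sum_of_subset_of_nonneg hsub fun q _ _ => h0 q).trans ?_
    have e1 := sum_union_inter (s₁ := S₂ ∪ S₃) (s₂ := S₄) (f := fun q : ℕ => (1 / q : ℝ))
    have e2 := sum_union_inter (s₁ := S₂) (s₂ := S₃) (f := fun q : ℕ => (1 / q : ℝ))
    have e3 : 0 ≤ ∑ q ∈ (S₂ ∪ S₃) ∩ S₄, (1 / q : ℝ) := sum_nonneg fun q _ => h0 q
    have e4 : 0 ≤ ∑ q ∈ S₂ ∩ S₃, (1 / q : ℝ) := sum_nonneg fun q _ => h0 q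
    linarith
  rw [abs_le] at h1 h2
  linarith

theorem exists_residues_dvd_sq_add_sq {q v : ℕ} (hq : q.Prime) (hq4 : q % 4 = 1) (hv : ¬ q ∣ v) :
    ∃ Ω : Finset (ZMod q), #Ω = 2 ∧ ∀ u : ℕ, (u : ZMod q) ∈ Ω → q ∣ u ^ 2 + v ^ 2 := by
  have := Fact.mk hq
  obtain ⟨i, hi⟩ := ZMod.exists_sq_eq_neg_one_iff.2 (show q % 4 ≠ 3 by omega)
  have hv' : (v : ZMod q) ≠ 0 := fun h => hv ((ZMod.natCast_eq_zero_iff _ _).1 h)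
  have h2 : (2 : ZMod q) ≠ 0 := by
    intro h
    have : q ∣ 2 := (ZMod.natCast_eq_zero_iff 2 q).1 (by exact_mod_cast h)
    have := (Nat.prime_dvd_prime_iff_eq hq Nat.prime_two).1 this
    omega
  have hi0 : i ≠ 0 := by
    rintro rfl
    simp at hi
  refine ⟨{i * v, -(i * v)}, card_pair fun h => ?_, fun u hu => ?_⟩
  · have : 2 * (i * v) = 0 := by linear_combination h
    simp [h2, hi0, hv'] at this
  · rw [← ZMod.natCast_eq_zero_iff]
    push_cast
    simp only [mem_insert, mem_singleton] at hu
    rcases hu with hu | hu <;> rw [hu] <;> linear_combination (-(v : ZMod q) ^ 2) * hi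

/-- The roots `-t.1 * v / t.2` are distinct modulo `q` since the determinants do not vanish there.
-/
theorem exists_residues_dvd_linear {q v : ℕ} (T : Finset (ℤ × ℤ)) (hq : q.Prime) (hv : ¬ q ∣ v)
    (hT : ∀ t ∈ T, ¬ (q : ℤ) ∣ t.2)
    (hdet : ∀ s ∈ T, ∀ t ∈ T, s ≠ t → ¬ (q : ℤ) ∣ s.1 * t.2 - s.2 * t.1) :
    ∃ Ω : Finset (ZMod q), #Ω = #T ∧
      ∀ u : ℕ, (u : ZMod q) ∈ Ω → ∃ t ∈ T, (q : ℤ) ∣ t.1 * v + t.2 * u := by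
  have := Fact.mk hq
  have hv' : (v : ZMod q) ≠ 0 := fun h => hv ((ZMod.natCast_eq_zero_iff _ _).1 h)
  have hT' : ∀ t ∈ T, (t.2 : ZMod q) ≠ 0 := fun t ht h =>
    hT t ht ((ZMod.intCast_zmod_eq_zero_iff_dvd _ _).1 h)
  refine ⟨T.image fun t => -(t.1 * v / t.2 : ZMod q), card_image_of_injOn ?_, fun u hu => ?_⟩
  · intro s hs t ht h
    by_contra hst
    refine hdet s hs t ht hst ((ZMod.intCast_zmod_eq_zero_iff_dvd _ _).1 ?_)
    have h : (s.1 * v / s.2 : ZMod q) = t.1 * v / t.2 := neg_injective h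
    rw [div_eq_div_iff (hT' s hs) (hT' t ht)] at h
    push_cast
    have : (v : ZMod q) * (s.1 * t.2 - s.2 * t.1) = 0 := by linear_combination h
    exact (mul_eq_zero.1 this).resolve_left hv'
  · obtain ⟨t, ht, h⟩ := mem_image.1 hu
    refine ⟨t, ht, (ZMod.intCast_zmod_eq_zero_iff_dvd _ _).1 ?_⟩
    have := hT' t ht
    push_cast
    rw [← h]
    field_simp
    ring

theorem eventually_mul_pow_le_exp (c : ℝ) (n : ℕ) :
    ∀ᶠ L : ℝ in Filter.atTop, c * L ^ n ≤ Real.exp L := by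
  filter_upwards [(Real.tendsto_exp_div_pow_atTop n).eventually_ge_atTop c,
    Filter.eventually_gt_atTop 0] with L h1 h2
  rwa [le_div_iff₀ (by positivity)] at h1

/-- A modulus divisible by every prime for which the linear forms `t.1 * v + t.2 * u`, `t ∈ T`, in
the variable `u` degenerate. -/
def degenerateModulus (T : Finset (ℤ × ℤ)) (v : ℕ) : ℕ :=
  v * (∏ t ∈ T, t.2.natAbs) * ∏ p ∈ T.offDiag, (p.1.1 * p.2.2 - p.1.2 * p.2.1).natAbs

theorem degenerateModulus_ne_zero {T : Finset (ℤ × ℤ)} {v : ℕ} (hv : v ≠ 0)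
    (hT : ∀ t ∈ T, t.2 ≠ 0) (hdet : ∀ s ∈ T, ∀ t ∈ T, s ≠ t → s.1 * t.2 - s.2 * t.1 ≠ 0) :
    degenerateModulus T v ≠ 0 := by
  refine mul_ne_zero (mul_ne_zero hv ?_) ?_
  · exact prod_ne_zero_iff.2 fun t ht => Int.natAbs_ne_zero.2 (hT t ht)
  · refine prod_ne_zero_iff.2 fun p hp => Int.natAbs_ne_zero.2 ?_
    obtain ⟨h1, h2, h3⟩ := mem_offDiag.1 hp
    exact hdet _ h1 _ h2 h3

/-- With `X = log x` the bound is `O(X)`, so the degenerate primes above `X` have bounded reciprocal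
sum. -/
theorem log_degenerateModulus_le {T : Finset (ℤ × ℤ)} {v : ℕ} (hv : v ≠ 0)
    (hT : ∀ t ∈ T, t.2 ≠ 0) (hdet : ∀ s ∈ T, ∀ t ∈ T, s ≠ t → s.1 * t.2 - s.2 * t.1 ≠ 0)
    {X : ℝ} (hX : 1 ≤ X) (hvX : (v : ℝ) ≤ Real.exp X)
    (hTX : ∀ t ∈ T, |(t.1 : ℝ)| ≤ Real.exp X ∧ |(t.2 : ℝ)| ≤ Real.exp X) :
    Real.log (degenerateModulus T v) ≤ (1 + #T + 3 * #T ^ 2) * X := by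
  have hlog : ∀ {a : ℝ} {c : ℝ}, a ≠ 0 → |a| ≤ Real.exp c → Real.log |a| ≤ c := fun h0 h => by
    rw [Real.log_le_iff_le_exp (abs_pos.2 h0)]; exact h
  have h1 : ∀ t ∈ T, ((t.2.natAbs : ℕ) : ℝ) ≠ 0 := fun t ht => by
    exact_mod_cast Int.natAbs_ne_zero.2 (hT t ht)
  have h2 : ∀ p ∈ T.offDiag, (((p.1.1 * p.2.2 - p.1.2 * p.2.1).natAbs : ℕ) : ℝ) ≠ 0 := fun p hp => by
    obtain ⟨a, b, c⟩ := mem_offDiag.1 hp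
    exact_mod_cast Int.natAbs_ne_zero.2 (hdet _ a _ b c)
  have hv0 : (v : ℝ) ≠ 0 := by exact_mod_cast hv
  rw [degenerateModulus]
  push_cast only [Nat.cast_mul, Nat.cast_prod]
  rw [Real.log_mul (mul_ne_zero hv0 (prod_ne_zero_iff.2 h1)) (prod_ne_zero_iff.2 h2),
    Real.log_mul hv0 (prod_ne_zero_iff.2 h1), Real.log_prod h1, Real.log_prod h2]
  have e1 : Real.log v ≤ X := by
    have := hlog hv0 (by rwa [Nat.abs_cast])
    rwa [Nat.abs_cast] at this
  have e2 : ∑ t ∈ T, Real.log (t.2.natAbs : ℕ) ≤ #T * X := by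
    rw [← nsmul_eq_mul]
    refine sum_le_card_nsmul _ _ _ fun t ht => ?_
    rw [Nat.cast_natAbs, Int.cast_abs]
    exact hlog (by exact_mod_cast hT t ht) (hTX t ht).2
  have e3 : ∑ p ∈ T.offDiag, Real.log ((p.1.1 * p.2.2 - p.1.2 * p.2.1).natAbs : ℕ)
      ≤ #T.offDiag * (3 * X) := by
    rw [← nsmul_eq_mul]
    refine sum_le_card_nsmul _ _ _ fun p hp => ?_
    obtain ⟨a, b, c⟩ := mem_offDiag.1 hp
    rw [Nat.cast_natAbs, Int.cast_abs]
    refine hlog (by exact_mod_cast hdet _ a _ b c) ?_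
    push_cast
    have m1 : |(p.1.1 : ℝ) * p.2.2| ≤ Real.exp X * Real.exp X := by
      rw [abs_mul]; exact mul_le_mul (hTX _ a).1 (hTX _ b).2 (abs_nonneg _) (Real.exp_pos _).le
    have m2 : |(p.1.2 : ℝ) * p.2.1| ≤ Real.exp X * Real.exp X := by
      rw [abs_mul]; exact mul_le_mul (hTX _ a).2 (hTX _ b).1 (abs_nonneg _) (Real.exp_pos _).le
    have m3 : 2 ≤ Real.exp X := by linarith [Real.add_one_le_exp X]
    refine (abs_sub _ _).trans ?_
    have : Real.exp (3 * X) = Real.exp X * (Real.exp X * Real.exp X) := by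
      rw [← Real.exp_add, ← Real.exp_add]; ring_nf
    rw [this]
    nlinarith [mul_pos (Real.exp_pos X) (Real.exp_pos X)]
  have e4 : (#T.offDiag : ℝ) ≤ #T ^ 2 := by
    rw [offDiag_card, sq]
    exact_mod_cast Nat.sub_le _ _
  have e5 : (#T.offDiag : ℝ) * (3 * X) ≤ #T ^ 2 * (3 * X) := by gcongr
  linarith

set_option maxHeartbeats 1000000 in
/-- Upper bound for the number of `u ≤ U` such that `u² + v²` has no small prime factor and the
linear forms `t.1 * v + t.2 * u`, `t ∈ T`, have no prime factor congruent to `3` modulo `4`. -/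
theorem exists_card_linear_forms_le (K : ℕ) :
    ∃ c L₀ : ℝ, 0 < c ∧ ∀ L : ℝ, L₀ ≤ L → ∀ T : Finset (ℤ × ℤ), #T = K →
      (∀ t ∈ T, |(t.1 : ℝ)| ≤ Real.exp (Real.exp L) ∧ |(t.2 : ℝ)| ≤ Real.exp (Real.exp L)) →
      (∀ t ∈ T, t.2 ≠ 0) → (∀ s ∈ T, ∀ t ∈ T, s ≠ t → s.1 * t.2 - s.2 * t.1 ≠ 0) →
      ∀ v : ℕ, v ≠ 0 → (v : ℝ) ≤ Real.exp (Real.exp L) →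
      ∀ U : ℕ, Real.exp (Real.exp L / (4 * L ^ 2)) ≤ U → ∀ S : Finset ℕ, S ⊆ Ioc 0 U →
      (∀ u ∈ S, ∀ q : ℕ, q.Prime → (q : ℝ) ≤ Real.exp (Real.exp L / L ^ 4) → ¬ q ∣ u ^ 2 + v ^ 2) →
      (∀ u ∈ S, ∀ t ∈ T, ∀ q : ℕ, q.Prime → q % 4 = 3 → ¬ (q : ℤ) ∣ t.1 * v + t.2 * u) →
      (#S : ℝ) ≤ c * U * L ^ (3 * (K + 2)) * Real.exp (-((K + 2) * L / 2)) := by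
  obtain ⟨B, hB0, hB⟩ := exists_le_sum_inv_prime_not_dvd
  obtain ⟨B', hB'⟩ := exists_abs_sum_inv_prime_mod_four_le
  set M : ℝ := 1 + K + 3 * K ^ 2 with hM
  set k : ℝ := K + 2 with hk
  have hk2 : 2 ≤ k := by simp [hk]
  obtain ⟨L₁, hL₁⟩ := Filter.eventually_atTop.1 ((eventually_mul_pow_le_exp k 4).and
    (eventually_mul_pow_le_exp (8 * (k + 2)) 3))
  refine ⟨2 * Real.exp (k * (B + M)) + 1, max L₁ (max (80 * k) (2 * B')), by positivity, ?_⟩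
  intro L hL T hT hTX hT0 hdet v hv hvX U hU S hSU hS1 hS2
  simp only [max_le_iff] at hL
  obtain ⟨hLL₁, hL80, hLB⟩ := hL
  have hL1 : 1 ≤ L := by linarith
  have hL0 : 0 < L := by linarith
  obtain ⟨hX4, hX3⟩ := hL₁ L hLL₁
  set X := Real.exp L with hXdef
  have hX0 : 0 < X := Real.exp_pos L
  have hXe : Real.exp 1 ≤ X := Real.exp_le_exp.2 hL1
  have hX1 : 1 ≤ X := by linarith [Real.exp_one_gt_d9]
  set z := Real.exp (X / L ^ 4) with hz
  have hzk : k ≤ z := by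
    have : k ≤ X / L ^ 4 := by rw [le_div_iff₀ (by positivity)]; exact hX4
    linarith [Real.add_one_le_exp (X / L ^ 4)]
  have hz0 : 0 < z := by linarith
  have hlz : Real.log (Real.log z) = L - 4 * Real.log L := by
    rw [hz, Real.log_exp, Real.log_div hX0.ne' (by positivity), Real.log_exp, Real.log_pow]
    norm_num
  have hlw : Real.log (Real.log X) = Real.log L := by rw [hXdef, Real.log_exp]
  have hlL : 0 ≤ Real.log L := Real.log_nonneg hL1
  set D := degenerateModulus T v with hD
  have hDne : D ≠ 0 := degenerateModulus_ne_zero hv hT0 hdet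
  have hlD : Real.log D / X ≤ M := by
    rw [div_le_iff₀ hX0]
    have := log_degenerateModulus_le hv hT0 hdet hX1 hvX hTX
    rwa [hT] at this
  set Q : ℕ → Finset ℕ := fun a => {q ∈ Ioc 0 ⌊z⌋₊ | (Nat.Prime q ∧ q % 4 = a) ∧ X < (q : ℝ) ∧ ¬ q ∣ D}
    with hQ
  have hQmem : ∀ {a q}, q ∈ Q a → q.Prime ∧ q % 4 = a ∧ (q : ℝ) ≤ z ∧ ¬ q ∣ D := by
    intro a q hq
    simp only [hQ, mem_filter, mem_Ioc] at hq
    exact ⟨hq.2.1.1, hq.2.1.2, (Nat.le_floor_iff hz0.le).1 hq.1.2, hq.2.2.2⟩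
  set σ : ℕ → ℝ := fun a => ∑ q ∈ Q a, (1 / q : ℝ) with hσ
  -- Of the loss `5 * log L`, four come from stopping at `z = exp (X / L ^ 4)` and one from starting
  -- at `X`; `M` pays for the primes dividing `D`.
  have hσlo : ∀ a, (a = 1 ∨ a = 3) → (L - 5 * Real.log L) / 2 - B - M ≤ σ a := by
    intro a ha
    have := hB a ha z X (by linarith) hXe D hDne
    rw [hlz, hlw] at this
    simp only [hσ, hQ]
    linarith
  have hσhi : ∀ a, (a = 1 ∨ a = 3) → σ a ≤ L := by
    intro a ha
    have h1 := hB' a ha z (by linarith)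
    rw [hlz, abs_le] at h1
    have h2 : σ a ≤ ∑ p ∈ Ioc 0 ⌊z⌋₊ with Nat.Prime p ∧ p % 4 = a, (1 / p : ℝ) := by
      refine sum_le_sum_of_subset_of_nonneg (fun q hq => ?_) fun q _ _ => by positivity
      simp only [hQ, mem_filter] at hq ⊢
      exact ⟨hq.1, hq.2.1⟩
    linarith
  have hdv : ∀ q, ¬ q ∣ D → ¬ q ∣ v := fun q h hd =>
    h (hD ▸ (Dvd.dvd.mul_right (Dvd.dvd.mul_right hd _) _))
  have hΩ : ∀ q, ∃ Ω : Finset (ZMod q), (q ∈ Q 1 → #Ω = 2 ∧ ∀ u : ℕ, (u : ZMod q) ∈ Ω → q ∣ u ^ 2 + v ^ 2)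
      ∧ (q ∈ Q 3 → #Ω = K ∧ ∀ u : ℕ, (u : ZMod q) ∈ Ω → ∃ t ∈ T, (q : ℤ) ∣ t.1 * v + t.2 * u) := by
    intro q
    by_cases h1 : q ∈ Q 1
    · obtain ⟨a, b, _, d⟩ := hQmem h1
      obtain ⟨Ω, hΩ⟩ := exists_residues_dvd_sq_add_sq a b (hdv q d)
      refine ⟨Ω, fun _ => hΩ, fun h3 => ?_⟩
      have := (hQmem h3).2.1
      omega
    by_cases h3 : q ∈ Q 3
    · obtain ⟨a, b, _, d⟩ := hQmem h3
      obtain ⟨Ω, hΩ⟩ := exists_residues_dvd_linear T a (hdv q d)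
        (fun t ht hd => d (hD ▸ (Dvd.dvd.mul_right (Dvd.dvd.mul_left
          ((Int.natCast_dvd.1 hd).trans (dvd_prod_of_mem (fun t : ℤ × ℤ => t.2.natAbs) ht)) _) _)))
        (fun s hs t ht hst hd => d (hD ▸ (Dvd.dvd.mul_left ((Int.natCast_dvd.1 hd).trans
          (dvd_prod_of_mem (fun p : (ℤ × ℤ) × (ℤ × ℤ) => (p.1.1 * p.2.2 - p.1.2 * p.2.1).natAbs)
            (mem_offDiag.2 ⟨hs, ht, hst⟩ : (s, t) ∈ T.offDiag))) _)))
      exact ⟨Ω, fun h => absurd h h1, fun _ => hT ▸ hΩ⟩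
    · exact ⟨∅, fun h => absurd h h1, fun h => absurd h h3⟩
  choose Ω hΩ1 hΩ3 using hΩ
  set P := Q 1 ∪ Q 3 with hP
  have hdisj : Disjoint (Q 1) (Q 3) := by
    rw [disjoint_left]
    intro q h1 h3
    have := (hQmem h1).2.1
    have := (hQmem h3).2.1
    omega
  have hPp : ∀ q ∈ P, q.Prime := fun q hq => by
    rcases mem_union.1 hq with h | h <;> exact (hQmem h).1
  have hG : ∑ q ∈ P, (#(Ω q) / q : ℝ) = 2 * σ 1 + K * σ 3 := by
    rw [hP, sum_union hdisj, hσ, mul_sum, mul_sum]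
    congr 1
    · refine sum_congr rfl fun q hq => ?_
      rw [(hΩ1 q hq).1]; push_cast; ring
    · refine sum_congr rfl fun q hq => ?_
      rw [(hΩ3 q hq).1]; ring
  have hcardS : S ⊆ {u ∈ Ioc 0 U | ∀ q ∈ P, ((u : ℕ) : ZMod q) ∉ Ω q} := by
    intro u hu
    refine mem_filter.2 ⟨hSU hu, fun q hq hmem => ?_⟩
    rcases mem_union.1 hq with h | h
    · exact hS1 u hu q (hQmem h).1 (hQmem h).2.2.1 ((hΩ1 q h).2 u hmem)
    · obtain ⟨t, ht, hd⟩ := (hΩ3 q h).2 u hmem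
      exact hS2 u hu t ht q (hQmem h).1 (hQmem h).2.1 hd
  have hK0 : (0 : ℝ) ≤ K := Nat.cast_nonneg K
  have hGhi : 2 * σ 1 + K * σ 3 ≤ k * L := by
    have := hσhi 1 (Or.inl rfl)
    have := mul_le_mul_of_nonneg_left (hσhi 3 (Or.inr rfl)) hK0
    linarith
  have hGlo : k * ((L - 5 * Real.log L) / 2 - B - M) ≤ 2 * σ 1 + K * σ 3 := by
    have := hσlo 1 (Or.inl rfl)
    have := mul_le_mul_of_nonneg_left (hσlo 3 (Or.inr rfl)) hK0
    linarith
  -- Even and at least four times the sieve sum, yet `O(L)`: then `(k * z) ^ r = exp (O(X / L ^ 3))`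
  -- stays well below `U ≥ exp (X / (4 * L ^ 2))`.
  set r := 2 * ⌈2 * k * L⌉₊ with hr
  have hr1 : 4 * (k * L) ≤ r := by
    have := Nat.le_ceil (2 * k * L)
    rw [hr]; push_cast; linarith
  have hr2 : (r : ℝ) ≤ 5 * (k * L) := by
    have := Nat.ceil_lt_add_one (show 0 ≤ 2 * k * L by positivity)
    rw [hr]; push_cast
    nlinarith
  have hcardP : ∑ q ∈ P, (#(Ω q) : ℝ) ≤ k * z := by
    have h1 : ∀ q ∈ P, (#(Ω q) : ℝ) ≤ k := by
      intro q hq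
      rcases mem_union.1 hq with h | h
      · rw [(hΩ1 q h).1]; push_cast; linarith
      · rw [(hΩ3 q h).1]; linarith
    have h2 : #P ≤ ⌊z⌋₊ := by
      have : P ⊆ Ioc 0 ⌊z⌋₊ := union_subset (filter_subset _ _) (filter_subset _ _)
      simpa using card_le_card this
    have h3 : (#P : ℝ) ≤ z := (Nat.cast_le.2 h2).trans (Nat.floor_le hz0.le)
    refine (sum_le_card_nsmul _ _ _ h1).trans ?_
    rw [nsmul_eq_mul, mul_comm]
    gcongr
  have hsieve := card_sieve_le Ω U P hPp (r := r) ⟨_, two_mul _⟩ (by rw [hG]; linarith)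
    (t := k * z) (by nlinarith) hcardP
  rw [hG] at hsieve
  have herr : Real.exp 1 * (k * z) ^ r ≤ U * Real.exp (-(k * L / 2)) := by
    calc Real.exp 1 * (k * z) ^ r ≤ Real.exp 1 * (z * z) ^ r := by gcongr
      _ = Real.exp (1 + r * (X / L ^ 4 + X / L ^ 4)) := by
          rw [hz, ← Real.exp_add, ← Real.exp_nat_mul, ← Real.exp_add]
      _ ≤ Real.exp (X / (4 * L ^ 2) + -(k * L / 2)) := by
          rw [Real.exp_le_exp]
          have h1 : r * (X / L ^ 4 + X / L ^ 4) ≤ 5 * (k * L) * (X / L ^ 4 + X / L ^ 4) := by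
            gcongr
          have h2 : 5 * (k * L) * (X / L ^ 4 + X / L ^ 4) = (10 * k) * (X / L ^ 3) := by
            field_simp; ring
          have h3 : (10 * k) * (X / L ^ 3) ≤ (L / 8) * (X / L ^ 3) := by
            gcongr; linarith
          have h4 : (L / 8) * (X / L ^ 3) = X / (8 * L ^ 2) := by field_simp
          have h5 : (k + 2) * L ≤ X / (8 * L ^ 2) := by
            rw [le_div_iff₀ (by positivity)]
            calc _ = 8 * (k + 2) * L ^ 3 := by ring
              _ ≤ X := hX3
          have h6 : X / (4 * L ^ 2) = X / (8 * L ^ 2) + X / (8 * L ^ 2) := by field_simp; ring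
          have h7 : 0 ≤ k * L := mul_nonneg (by linarith) hL0.le
          linarith
      _ = Real.exp (X / (4 * L ^ 2)) * Real.exp (-(k * L / 2)) := Real.exp_add _ _
      _ ≤ _ := by gcongr
  -- The loss is `L ^ (5k/2)`, rounded up to the integral exponent `3k` with `k = K + 2`.
  have hmain : Real.exp (-(2 * σ 1 + K * σ 3)) ≤
      Real.exp (k * (B + M)) * L ^ (3 * (K + 2)) * Real.exp (-(k * L / 2)) := by
    have : L ^ (3 * (K + 2)) = Real.exp (3 * k * Real.log L) := by
      rw [← Real.rpow_natCast, Real.rpow_def_of_pos hL0]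
      congr 1
      rw [hk]; push_cast; ring
    rw [this, ← Real.exp_add, ← Real.exp_add, Real.exp_le_exp]
    linarith [mul_nonneg (show 0 ≤ k by linarith) hlL]
  have hLpow : 1 ≤ L ^ (3 * (K + 2)) := one_le_pow₀ hL1
  have hU0 : (0 : ℝ) ≤ U := Nat.cast_nonneg U
  calc (#S : ℝ) ≤ _ := by exact_mod_cast card_le_card hcardS
    _ ≤ 2 * U * Real.exp (-(2 * σ 1 + K * σ 3)) + Real.exp 1 * (k * z) ^ r := hsieve
    _ ≤ 2 * U * (Real.exp (k * (B + M)) * L ^ (3 * (K + 2)) * Real.exp (-(k * L / 2)))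
        + U * L ^ (3 * (K + 2)) * Real.exp (-(k * L / 2)) := by
        refine add_le_add (mul_le_mul_of_nonneg_left hmain (by linarith)) (herr.trans ?_)
        exact mul_le_mul_of_nonneg_right (le_mul_of_one_le_right hU0 hLpow) (Real.exp_pos _).le
    _ = _ := by rw [hk]; ring

/-! ### Summation over the large prime, for a fixed cofactor. -/

theorem abs_le_of_mem_primReps {m : ℕ} {t : ℤ × ℤ} (ht : t ∈ primReps m) :
    |(t.1 : ℝ)| ≤ m ∧ |(t.2 : ℝ)| ≤ m := by
  have key : ∀ x y : ℤ, x ^ 2 + y ^ 2 = m → |(x : ℝ)| ≤ m := by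
    intro x y h
    have h1 : |x| ≤ |x| ^ 2 := Int.le_self_sq _
    rw [sq_abs] at h1
    have : |x| ≤ m := by nlinarith [sq_nonneg y]
    exact_mod_cast this
  have h := (mem_primReps.1 ht).1
  exact ⟨key _ _ h, key t.2 t.1 (by linarith)⟩

/-- Two members with vanishing second coordinate would be proportional, so discarding one member
leaves `K` forms that involve `u`. This lost form is why the exponent is `ℓ + 1`. -/
theorem exists_subset_of_mem_repFamilies {m K : ℕ} {T : Finset (ℤ × ℤ)}
    (hT : T ∈ repFamilies m (K + 1)) :
    ∃ T' ⊆ T, #T' = K ∧ ∀ t ∈ T', t.2 ≠ 0 := by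
  classical
  obtain ⟨hT1, hT2⟩ := mem_filter.1 hT
  obtain ⟨hT3, hT4⟩ := mem_powersetCard.1 hT1
  have h1 : #{t ∈ T | ¬ t.2 ≠ 0} ≤ 1 := by
    rw [card_le_one]
    intro a ha b hb
    simp only [mem_filter, not_not] at ha hb
    by_contra hab
    exact hT2 a ha.1 b hb.1 hab (by rw [ha.2, hb.2]; ring)
  have h2 := card_filter_add_card_filter_not (s := T) (fun t => t.2 ≠ 0)
  obtain ⟨T', hT', hc⟩ := exists_subset_card_eq (show K ≤ #{t ∈ T | t.2 ≠ 0} by omega)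
  exact ⟨T', hT'.trans (filter_subset _ _), hc, fun t ht => (mem_filter.1 (hT' ht)).2⟩

/-- For each fixed second coordinate the sieve bounds the first; summing over at most `U` values of
the second gives `U ^ 2`. -/
theorem exists_card_pairs_le (K : ℕ) :
    ∃ c L₀ : ℝ, 0 < c ∧ ∀ L : ℝ, L₀ ≤ L → ∀ m : ℕ, (m : ℝ) ≤ Real.exp (Real.exp L) →
      ∀ T ∈ repFamilies m (K + 1), ∀ U : ℕ, Real.exp (Real.exp L / (4 * L ^ 2)) ≤ U →
      (U : ℝ) ≤ Real.exp (Real.exp L) → ∀ W ⊆ Ioc 0 U ×ˢ Ioc 0 U,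
      (∀ w ∈ W, (w.1 ^ 2 + w.2 ^ 2).Prime ∧
        Real.exp (Real.exp L / L ^ 4) < ((w.1 ^ 2 + w.2 ^ 2 : ℕ) : ℝ) ∧
        ∀ t ∈ T, (t.1 * (w.2 : ℤ) + t.2 * (w.1 : ℤ)).natAbs ∈ R') →
      (#W : ℝ) ≤ c * U ^ 2 * L ^ (3 * (K + 2)) * Real.exp (-((K + 2) * L / 2)) := by
  obtain ⟨c, L₀, hc, h⟩ := exists_card_linear_forms_le K
  refine ⟨c, L₀, hc, fun L hL m hm T hT U hU hUX W hW hWT => ?_⟩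
  obtain ⟨T', hT', hcard, hne⟩ := exists_subset_of_mem_repFamilies hT
  obtain ⟨hT1, hT2⟩ := mem_filter.1 hT
  obtain ⟨hT3, hT4⟩ := mem_powersetCard.1 hT1
  set b := c * U * L ^ (3 * (K + 2)) * Real.exp (-((K + 2) * L / 2)) with hb
  have hfib : ∀ v ∈ Ioc 0 U, (#{w ∈ W | w.2 = v} : ℝ) ≤ b := by
    intro v hv
    have hinj : #({w ∈ W | w.2 = v}.image Prod.fst) = #{w ∈ W | w.2 = v} := by
      refine card_image_of_injOn fun w hw w' hw' e => ?_
      have h1 := (mem_filter.1 (mem_coe.1 hw)).2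
      have h2 := (mem_filter.1 (mem_coe.1 hw')).2
      exact Prod.ext e (h1.trans h2.symm)
    rw [← hinj]
    have hmem : ∀ u ∈ {w ∈ W | w.2 = v}.image Prod.fst, (u, v) ∈ W := by
      intro u hu
      obtain ⟨w, hw, rfl⟩ := mem_image.1 hu
      obtain ⟨h1, rfl⟩ := mem_filter.1 hw
      exact h1
    have hvU : (v : ℝ) ≤ U := by exact_mod_cast (mem_Ioc.1 hv).2
    refine h L hL T' hcard (fun t ht => ?_) hne
      (fun s hs t ht => hT2 s (hT' hs) t (hT' ht)) v (by have := (mem_Ioc.1 hv).1; omega)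
      (hvU.trans hUX) U hU _ (fun u hu => (mem_product.1 (hW (hmem u hu))).1) ?_ ?_
    · have := abs_le_of_mem_primReps (hT3 (hT' ht))
      exact ⟨this.1.trans hm, this.2.trans hm⟩
    · intro u hu q hq hqz hd
      obtain ⟨h1, h2, -⟩ := hWT _ (hmem u hu)
      have := (Nat.prime_dvd_prime_iff_eq hq h1).1 hd
      rw [← this] at h2
      exact absurd hqz (not_le.2 h2)
    · intro u hu t ht q hq hq4 hd
      obtain ⟨-, -, h3⟩ := hWT _ (hmem u hu)
      exact not_dvd_of_mem_R' (h3 t (hT' ht)) hq hq4 (Int.natCast_dvd.1 hd)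
  have hsum : #W = ∑ v ∈ Ioc 0 U, #{w ∈ W | w.2 = v} :=
    card_eq_sum_card_fiberwise fun w hw => (mem_product.1 (hW hw)).2
  calc (#W : ℝ) = ∑ v ∈ Ioc 0 U, (#{w ∈ W | w.2 = v} : ℝ) := by rw [hsum]; push_cast; rfl
    _ ≤ ∑ v ∈ Ioc 0 U, b := sum_le_sum hfib
    _ = U * b := by rw [sum_const, Nat.card_Ioc, nsmul_eq_mul]; simp
    _ = _ := by rw [hb]; ring

theorem exists_sum_choose_repStar_mul_prime_le (K : ℕ) :
    ∃ c L₀ : ℝ, 0 < c ∧ ∀ L : ℝ, L₀ ≤ L → ∀ m : ℕ, m ≠ 0 →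
      m * Real.exp (Real.exp L / L ^ 2) ≤ Real.exp (Real.exp L) → ∀ Q : Finset ℕ,
      (∀ p ∈ Q, p.Prime ∧ p % 4 ≠ 3 ∧ Real.exp (Real.exp L / L ^ 2) < (p : ℝ) ∧
        (m * p : ℝ) ≤ Real.exp (Real.exp L)) →
      ∑ p ∈ Q, ((repStar R' (m * p)).choose (K + 1) : ℝ)
        ≤ (4 * 2 ^ omegaStar m) ^ (K + 1) * (c * (Real.exp (Real.exp L) / m) * L ^ (3 * (K + 2))
          * Real.exp (-((K + 2) * L / 2))) := by
  classical
  obtain ⟨c, L₀, hc, h⟩ := exists_card_pairs_le K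
  obtain ⟨L₁, hL₁⟩ := Filter.eventually_atTop.1 (eventually_mul_pow_le_exp 4 2)
  refine ⟨c, max L₀ (max L₁ 1), hc, fun L hL m hm hmy Q hQ => ?_⟩
  simp only [max_le_iff] at hL
  obtain ⟨hL0, hL1', hL1⟩ := hL
  have hX := hL₁ L hL1'
  set X := Real.exp L
  have hX0 : 0 < X := Real.exp_pos L
  have hL0' : 0 < L := by linarith
  set x := Real.exp X
  have hx0 : 0 < x := Real.exp_pos X
  have hx1 : 1 ≤ x := Real.one_le_exp hX0.le
  have hm0 : (0 : ℝ) < m := by exact_mod_cast Nat.pos_of_ne_zero hm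
  have hm1 : (1 : ℝ) ≤ m := by exact_mod_cast Nat.one_le_iff_ne_zero.2 hm
  set a := X / (4 * L ^ 2) with ha
  have ha1 : 1 ≤ a := by rw [ha, one_le_div (by positivity)]; exact hX
  have hy : Real.exp (X / L ^ 2) = (Real.exp (2 * a)) ^ 2 := by
    rw [← Real.exp_nat_mul]; congr 1; rw [ha]; field_simp; norm_num
  set U := ⌊√(x / m)⌋₊ with hU
  have hUle : (U : ℝ) ≤ √(x / m) := Nat.floor_le (Real.sqrt_nonneg _)
  have hUsq : (U : ℝ) ^ 2 ≤ x / m := by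
    calc (U : ℝ) ^ 2 ≤ √(x / m) ^ 2 := by gcongr
      _ = x / m := Real.sq_sqrt (by positivity)
  -- From `m * y ≤ x` one gets `√(x / m) ≥ √y = exp (2 * a)`; halving the exponent pays for the
  -- floor.
  have hUlo : Real.exp a ≤ U := by
    have h1 : Real.exp (2 * a) ≤ √(x / m) := by
      apply Real.le_sqrt_of_sq_le
      rw [← hy, le_div_iff₀ hm0]; linarith
    have h2 : Real.exp (2 * a) = Real.exp a * Real.exp a := by rw [← Real.exp_add]; ring_nf
    have h3 : 2 ≤ Real.exp a := by linarith [Real.add_one_le_exp a]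
    have h4 : √(x / m) < U + 1 := Nat.lt_floor_add_one _
    nlinarith
  have hUx : (U : ℝ) ≤ x := by
    refine hUle.trans ?_
    rw [Real.sqrt_le_left hx0.le]
    calc x / m ≤ x := div_le_self hx0.le hm1
      _ ≤ x ^ 2 := by nlinarith
  have huv : ∀ p, ∃ u v : ℕ, p ∈ Q → u ^ 2 + v ^ 2 = p := by
    intro p
    by_cases hp : p ∈ Q
    · obtain ⟨h1, h2, -⟩ := hQ p hp
      have := Fact.mk h1
      obtain ⟨u, v, huv⟩ := Nat.Prime.sq_add_sq h2
      exact ⟨u, v, fun _ => huv⟩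
    · exact ⟨0, 0, fun h => absurd h hp⟩
  choose u v huv using huv
  have hT : ∀ T ∈ repFamilies m (K + 1),
      (#{p ∈ Q | ∀ t ∈ T, (t.1 * (v p : ℤ) + t.2 * (u p : ℤ)).natAbs ∈ R'} : ℝ)
        ≤ c * U ^ 2 * L ^ (3 * (K + 2)) * Real.exp (-((K + 2) * L / 2)) := by
    intro T hT
    set Q' := {p ∈ Q | ∀ t ∈ T, (t.1 * (v p : ℤ) + t.2 * (u p : ℤ)).natAbs ∈ R'} with hQ'
    have hinj : #(Q'.image fun p => (u p, v p)) = #Q' := by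
      refine card_image_of_injOn fun p hp p' hp' e => ?_
      rw [← huv p (mem_filter.1 (mem_coe.1 hp)).1, ← huv p' (mem_filter.1 (mem_coe.1 hp')).1]
      simp only [Prod.mk.injEq] at e
      rw [e.1, e.2]
    rw [← hinj]
    refine h L hL0 m ?_ T hT U hUlo hUx _ (fun w hw => ?_) (fun w hw => ?_)
    · refine le_trans ?_ hmy
      exact le_mul_of_one_le_right hm0.le (Real.one_le_exp (by positivity))
    · obtain ⟨p, hp, rfl⟩ := mem_image.1 hw
      have hpQ := (mem_filter.1 hp).1
      obtain ⟨h1, h2, h3, h4⟩ := hQ p hpQ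
      have hp := huv p hpQ
      -- A prime is not a square, so both coordinates are positive.
      have hnsq : ∀ w : ℕ, w ^ 2 ≠ p := fun w hw => h1.not_isSquare ⟨w, by rw [← hw, sq]⟩
      have hle : ∀ w : ℕ, w ^ 2 ≤ p → w ≤ U := by
        intro w hw
        refine Nat.le_floor (Real.le_sqrt_of_sq_le ?_)
        rw [le_div_iff₀ hm0]
        have : ((w ^ 2 : ℕ) : ℝ) ≤ p := by exact_mod_cast hw
        push_cast at this
        nlinarith
      simp only [mem_product, mem_Ioc]
      refine ⟨⟨Nat.pos_of_ne_zero fun h0 => ?_, hle _ (by omega)⟩,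
        Nat.pos_of_ne_zero fun h0 => ?_, hle _ (by omega)⟩
      · exact hnsq (v p) (by rw [h0] at hp; simpa using hp)
      · exact hnsq (u p) (by rw [h0] at hp; simpa using hp)
    · obtain ⟨p, hp, rfl⟩ := mem_image.1 hw
      obtain ⟨hpQ, hpT⟩ := mem_filter.1 hp
      obtain ⟨h1, h2, h3, h4⟩ := hQ p hpQ
      simp only [huv p hpQ]
      refine ⟨h1, lt_of_le_of_lt (Real.exp_le_exp.2 ?_) h3, hpT⟩
      gcongr
      norm_num
  have hchoose : ∀ p ∈ Q, ((repStar R' (m * p)).choose (K + 1) : ℝ)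
      ≤ ∑ T ∈ repFamilies m (K + 1),
        if ∀ t ∈ T, (t.1 * (v p : ℤ) + t.2 * (u p : ℤ)).natAbs ∈ R' then (1 : ℝ) else 0 := by
    intro p hp
    rw [sum_boole]
    exact_mod_cast choose_repStar_le R' (hQ p hp).1 (huv p hp) (K + 1)
  refine (sum_le_sum hchoose).trans ?_
  rw [sum_comm]
  simp only [sum_boole]
  refine (sum_le_card_nsmul _ _ _ hT).trans ?_
  rw [nsmul_eq_mul]
  have hcard : (#(repFamilies m (K + 1)) : ℝ) ≤ (4 * 2 ^ omegaStar m) ^ (K + 1) := by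
    exact_mod_cast card_repFamilies_le m (K + 1) hm
  gcongr

/-! ### Summation over the cofactor. -/

theorem omegaStar_mul_prime {p m : ℕ} (hp : p.Prime) (hodd : Odd p) (hm : m ≠ 0) :
    omegaStar (m * p) = if p ∣ m then omegaStar m else omegaStar m + 1 := by
  split_ifs with h
  · rw [omegaStar, omegaStar, Nat.primeFactors_mul hm hp.ne_zero, hp.primeFactors,
      union_eq_left.2 (singleton_subset_iff.2 (hp.mem_primeFactors h hm))]
  · rw [omegaStar_mul_of_coprime ((Nat.Prime.coprime_iff_not_dvd hp).2 h).symm]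
    congr 1
    rw [omegaStar, hp.primeFactors, filter_singleton, if_pos hodd, card_singleton]

open Classical in
/-- The `m ≤ N` with `j` odd prime factors modulo which `-1` is a square. -/
noncomputable def splitNumbers (N j : ℕ) : Finset ℕ :=
  {m ∈ Ioc 0 N | omegaStar m = j ∧ IsSquare (-1 : ZMod m)}

theorem mem_splitNumbers {N j m : ℕ} :
    m ∈ splitNumbers N j ↔ (0 < m ∧ m ≤ N) ∧ omegaStar m = j ∧ IsSquare (-1 : ZMod m) := by
  simp [splitNumbers]

theorem mod_four_eq_one_of_isSquare {m p : ℕ} (hp : p.Prime) (hodd : Odd p) (h : p ∣ m)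
    (hm : IsSquare (-1 : ZMod m)) : p % 4 = 1 := by
  have h3 := Nat.mod_four_ne_three_of_mem_primeFactors_of_isSquare_neg_one
    hp.mem_primeFactors_self (ZMod.isSquare_neg_one_of_dvd h hm)
  have := Nat.odd_iff.1 hodd
  omega

/-- Dividing by `p` sends the multiples of `p` either to numbers with one odd prime fewer or back to
multiples of `p`. So their sum `A` satisfies `A ≤ (S + A) / p`, and solving for `A` produces `1 / (p
- 1)`. -/
theorem sum_splitNumbers_dvd_le {N j p : ℕ} (hp : p.Prime) (hodd : Odd p) :
    ∑ m ∈ splitNumbers N (j + 1) with p ∣ m, (1 / m : ℝ)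
      ≤ 1 / (p - 1) * ∑ m ∈ splitNumbers N j, (1 / m : ℝ) := by
  classical
  set A := {m ∈ splitNumbers N (j + 1) | p ∣ m} with hA
  have hp1 : (1 : ℝ) < p := by exact_mod_cast hp.one_lt
  have hdiv : ∀ m ∈ A, m / p * p = m := fun m hm => Nat.div_mul_cancel (mem_filter.1 hm).2
  have hinj : Set.InjOn (fun m => m / p) (A : Set ℕ) := fun a ha b hb e => by
    rw [← hdiv a ha, ← hdiv b hb]; exact congrArg (· * p) e
  have himg : A.image (fun m => m / p) ⊆ splitNumbers N j ∪ A := by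
    intro m' hm'
    obtain ⟨m, hm, rfl⟩ := mem_image.1 hm'
    have hd := hdiv m hm
    obtain ⟨⟨hm0, hmN⟩, hm1, hm2⟩ := mem_splitNumbers.1 (mem_filter.1 hm).1
    have hd0 : m / p ≠ 0 := by rintro h; rw [h] at hd; omega
    have hom := omegaStar_mul_prime hp hodd hd0
    rw [hd, hm1] at hom
    have hle : m / p ≤ N := (Nat.div_le_self _ _).trans hmN
    have hsq : IsSquare (-1 : ZMod (m / p)) :=
      ZMod.isSquare_neg_one_of_dvd (Nat.div_dvd_of_dvd (mem_filter.1 hm).2) hm2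
    rw [mem_union]
    split_ifs at hom with h
    · right
      exact mem_filter.2 ⟨mem_splitNumbers.2 ⟨⟨Nat.pos_of_ne_zero hd0, hle⟩, hom.symm, hsq⟩, h⟩
    · left
      exact mem_splitNumbers.2 ⟨⟨Nat.pos_of_ne_zero hd0, hle⟩, by omega, hsq⟩
  have hpos : ∀ m : ℕ, 0 ≤ (1 / m : ℝ) := fun m => by positivity
  have hkey : ∑ m ∈ A, (1 / m : ℝ)
      ≤ 1 / p * (∑ m ∈ splitNumbers N j, (1 / m : ℝ) + ∑ m ∈ A, (1 / m : ℝ)) := by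
    calc ∑ m ∈ A, (1 / m : ℝ) = ∑ m ∈ A, 1 / p * (1 / (m / p : ℕ) : ℝ) := by
          refine sum_congr rfl fun m hm => ?_
          nth_rw 1 [← hdiv m hm]
          push_cast
          rw [one_div_mul_one_div, mul_comm]
      _ = 1 / p * ∑ m ∈ A.image (fun m => m / p), (1 / m : ℝ) := by
          rw [← mul_sum, sum_image hinj]
      _ ≤ 1 / p * ∑ m ∈ splitNumbers N j ∪ A, (1 / m : ℝ) := by
          gcongr
      _ ≤ _ := by
          gcongr
          have := sum_union_inter (s₁ := splitNumbers N j) (s₂ := A) (f := fun m : ℕ => (1 / m : ℝ))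
          have : 0 ≤ ∑ m ∈ splitNumbers N j ∩ A, (1 / m : ℝ) := sum_nonneg fun m _ => hpos m
          linarith
  rw [one_div_mul_eq_div, le_div_iff₀ (by linarith)] at *
  linarith

/-- Count pairs `(p, m)` with `p` an odd prime divisor of `m`: each `m` occurs `j + 1` times, and `p
≡ 1 (mod 4)` because `-1` is a square modulo `m`. -/
theorem sum_splitNumbers_succ_le (N j : ℕ) :
    (j + 1) * ∑ m ∈ splitNumbers N (j + 1), (1 / m : ℝ)
      ≤ (∑ p ∈ Ioc 0 N with Nat.Prime p ∧ p % 4 = 1, (1 / (p - 1) : ℝ))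
        * ∑ m ∈ splitNumbers N j, (1 / m : ℝ) := by
  classical
  have h1 : ∀ m ∈ splitNumbers N (j + 1), (j + 1) * (1 / m : ℝ)
      = ∑ p ∈ Ioc 0 N with Nat.Prime p ∧ p % 4 = 1, if p ∣ m then (1 / m : ℝ) else 0 := by
    intro m hm
    obtain ⟨⟨hm0, hmN⟩, hm1, hm2⟩ := mem_splitNumbers.1 hm
    rw [← sum_filter, sum_const, nsmul_eq_mul]
    congr 1
    have : {p ∈ {p ∈ Ioc 0 N | Nat.Prime p ∧ p % 4 = 1} | p ∣ m}
        = m.primeFactors.filter fun p => Odd p := by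
      ext p
      simp only [mem_filter, mem_Ioc, Nat.mem_primeFactors]
      constructor
      · rintro ⟨⟨-, h2, h3⟩, h4⟩
        exact ⟨⟨h2, h4, hm0.ne'⟩, Nat.odd_iff.2 (by omega)⟩
      · rintro ⟨⟨h2, h4, h5⟩, h6⟩
        exact ⟨⟨⟨h2.pos, (Nat.le_of_dvd hm0 h4).trans hmN⟩, h2,
          mod_four_eq_one_of_isSquare h2 h6 h4 hm2⟩, h4⟩
    rw [this, ← omegaStar, hm1]; push_cast; rfl
  rw [mul_sum, sum_congr rfl h1, sum_comm, sum_mul]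
  refine sum_le_sum fun p hp => ?_
  rw [← sum_filter]
  obtain ⟨-, hp1, hp2⟩ := mem_filter.1 hp
  exact sum_splitNumbers_dvd_le hp1 (Nat.odd_iff.2 (by omega))

theorem le_two_of_omegaStar_eq_zero {m : ℕ} (hm : omegaStar m = 0) (hm0 : m ≠ 0)
    (h : IsSquare (-1 : ZMod m)) : m ≤ 2 := by
  rcases Nat.eq_two_pow_or_exists_odd_prime_and_dvd m with ⟨k, rfl⟩ | ⟨p, hp, hd, hodd⟩
  · by_contra hk
    have : 2 ≤ k := by
      by_contra hk'
      have : k = 0 ∨ k = 1 := by omega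
      rcases this with rfl | rfl <;> simp at hk
    exact not_isSquare_neg_one_zmod_four (ZMod.isSquare_neg_one_of_dvd (pow_dvd_pow 2 this) h)
  · rw [omegaStar, card_eq_zero] at hm
    exact absurd (mem_filter.2 ⟨hp.mem_primeFactors hd hm0, hodd⟩) (hm ▸ notMem_empty p)

/-- Iterates the previous inequality down to `j = 0`, where only `m = 1, 2` remain. Only half of the
primes enter, which later gives `L / 2` in place of `L`. -/
theorem sum_splitNumbers_le (N j : ℕ) :
    ∑ m ∈ splitNumbers N j, (1 / m : ℝ)
      ≤ 2 * (∑ p ∈ Ioc 0 N with Nat.Prime p ∧ p % 4 = 1, (1 / (p - 1) : ℝ)) ^ j / j.factorial := by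
  set E := ∑ p ∈ Ioc 0 N with Nat.Prime p ∧ p % 4 = 1, (1 / (p - 1) : ℝ) with hE
  have hE0 : 0 ≤ E := sum_nonneg fun p hp => by
    have : (1 : ℝ) < p := by exact_mod_cast (mem_filter.1 hp).2.1.one_lt
    exact one_div_nonneg.2 (by linarith)
  induction j with
  | zero =>
    have hsub : splitNumbers N 0 ⊆ {1, 2} := by
      intro m hm
      obtain ⟨⟨hm0, hmN⟩, hm1, hm2⟩ := mem_splitNumbers.1 hm
      have := le_two_of_omegaStar_eq_zero hm1 hm0.ne' hm2
      simp only [mem_insert, mem_singleton]; omega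
    refine (sum_le_sum_of_subset_of_nonneg hsub fun m _ _ => by positivity).trans ?_
    norm_num
  | succ j ih =>
    have h := sum_splitNumbers_succ_le N j
    have h2 := mul_le_mul_of_nonneg_left ih hE0
    rw [Nat.factorial_succ, le_div_iff₀ (by positivity)]
    push_cast
    rw [mul_div_assoc', le_div_iff₀ (by positivity)] at h2
    calc _ = ((j + 1) * ∑ m ∈ splitNumbers N (j + 1), (1 / m : ℝ)) * j.factorial := by ring
      _ ≤ (E * ∑ m ∈ splitNumbers N j, (1 / m : ℝ)) * j.factorial := by gcongr
      _ ≤ _ := h2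
      _ = _ := by ring

theorem exists_sum_inv_prime_sub_one_le :
    ∃ B : ℝ, 0 ≤ B ∧ ∀ t : ℝ, 2 ≤ t → ∑ p ∈ Ioc 0 ⌊t⌋₊ with Nat.Prime p ∧ p % 4 = 1, (1 / (p - 1) : ℝ)
      ≤ Real.log (Real.log t) / 2 + B := by
  obtain ⟨B, hB⟩ := exists_abs_sum_inv_prime_mod_four_le
  refine ⟨B + 2, by linarith [(abs_nonneg _).trans (hB 1 (Or.inl rfl) 2 le_rfl)], fun t ht => ?_⟩
  have h := hB 1 (Or.inl rfl) t ht
  have h2 : 1 ≤ ⌊t⌋₊ := Nat.le_floor (by simp; linarith)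
  have h3 : ∀ p ∈ {p ∈ Ioc 0 ⌊t⌋₊ | Nat.Prime p ∧ p % 4 = 1},
      (1 / (p - 1) : ℝ) ≤ 1 / p + 2 * ((p : ℝ) ^ 2)⁻¹ := by
    intro p hp
    have h2 : (2 : ℝ) ≤ p := by exact_mod_cast (mem_filter.1 hp).2.1.two_le
    have : (1 / p : ℝ) + 2 * ((p : ℝ) ^ 2)⁻¹ = (p + 2) / p ^ 2 := by field_simp
    rw [this, div_le_div_iff₀ (by linarith) (by positivity)]
    nlinarith
  have h4 : ∑ p ∈ Ioc 0 ⌊t⌋₊ with Nat.Prime p ∧ p % 4 = 1, ((p : ℝ) ^ 2)⁻¹ ≤ 1 := by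
    have hsub : {p ∈ Ioc 0 ⌊t⌋₊ | Nat.Prime p ∧ p % 4 = 1} ⊆ Ioc 1 ⌊t⌋₊ := by
      intro p hp
      obtain ⟨h1, h2, -⟩ := mem_filter.1 hp
      exact mem_Ioc.2 ⟨h2.one_lt, (mem_Ioc.1 h1).2⟩
    refine (sum_le_sum_of_subset_of_nonneg hsub fun p _ _ => by positivity).trans ?_
    refine (sum_Ioc_inv_sq_le_sub one_ne_zero h2).trans ?_
    simp
  refine (sum_le_sum h3).trans ?_
  rw [sum_add_distrib, ← mul_sum]
  rw [abs_le] at h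
  linarith

/-! ### Splitting off a large prime, and the exceptional integers. -/

theorem le_two_mul_pow_omegaStar {n : ℕ} (hn : n ≠ 0) (hs : IsSquare (-1 : ZMod n)) {y : ℝ}
    (h : ∀ p : ℕ, p.Prime → Odd p → p ∣ n → (p : ℝ) ^ n.factorization p ≤ y) :
    (n : ℝ) ≤ 2 * y ^ omegaStar n := by
  have hprod : (n : ℝ) = ∏ p ∈ n.primeFactors, (p : ℝ) ^ n.factorization p := by
    have := Nat.prod_factorization_pow_eq_self hn
    nth_rw 1 [← this]
    rw [Finsupp.prod, Nat.support_factorization]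
    push_cast; rfl
  have htwo : ∏ p ∈ n.primeFactors with ¬ Odd p, (p : ℝ) ^ n.factorization p ≤ 2 := by
    have hsub : {p ∈ n.primeFactors | ¬ Odd p} ⊆ {2} := by
      intro p hp
      obtain ⟨h1, h2⟩ := mem_filter.1 hp
      exact mem_singleton.2 (((Nat.prime_of_mem_primeFactors h1).eq_two_or_odd').resolve_right h2)
    rcases subset_singleton_iff.1 hsub with h0 | h0
    · rw [h0]; norm_num
    · rw [h0, prod_singleton]
      have : n.factorization 2 ≤ 1 := by
        by_contra h2
        have h4 : 2 ^ 2 ∣ n := (Nat.prime_two.pow_dvd_iff_le_factorization hn).2 (by omega)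
        exact not_isSquare_neg_one_zmod_four (ZMod.isSquare_neg_one_of_dvd h4 hs)
      calc ((2 : ℕ) : ℝ) ^ n.factorization 2 ≤ ((2 : ℕ) : ℝ) ^ 1 :=
            pow_le_pow_right₀ (by norm_num) this
        _ = 2 := by norm_num
  have hoddp : ∏ p ∈ n.primeFactors with Odd p, (p : ℝ) ^ n.factorization p ≤ y ^ omegaStar n := by
    rw [omegaStar, ← prod_const]
    refine prod_le_prod (fun p _ => by positivity) fun p hp => ?_
    obtain ⟨h1, h2⟩ := mem_filter.1 hp
    exact h p (Nat.prime_of_mem_primeFactors h1) h2 (Nat.dvd_of_mem_primeFactors h1)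
  rw [hprod, ← prod_filter_not_mul_prod_filter n.primeFactors (fun p => Odd p)]
  exact mul_le_mul htwo hoddp (prod_nonneg fun p _ => by positivity) (by norm_num)

/-- Since 4 does not divide `n`, some odd prime power exactly dividing `n` must exceed `y`: either
it is a prime, or it contains a large square. -/
theorem exists_large_prime_or_square_dvd {n : ℕ} (hn : n ≠ 0) (hs : IsSquare (-1 : ZMod n)) {y : ℝ}
    (h : 2 * y ^ omegaStar n < n) :
    (∃ s : ℕ, y < (s : ℝ) ^ 3 ∧ s ^ 2 ∣ n) ∨
      ∃ m p : ℕ, n = m * p ∧ p.Prime ∧ p % 4 = 1 ∧ y < p ∧ omegaStar n = omegaStar m + 1 := by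
  obtain ⟨p, hp, hodd, hd, hy⟩ : ∃ p : ℕ, p.Prime ∧ Odd p ∧ p ∣ n ∧
      y < (p : ℝ) ^ n.factorization p := by
    by_contra! hcon
    exact absurd (le_two_mul_pow_omegaStar hn hs hcon) (not_le.2 h)
  set e := n.factorization p with he
  have he0 : e ≠ 0 := (hp.factorization_pos_of_dvd hn hd).ne'
  have hp1 : (1 : ℝ) ≤ p := by exact_mod_cast hp.one_lt.le
  rcases Nat.lt_or_ge e 2 with he2 | he2
  · right
    have he1 : e = 1 := by omega
    have hm : n = n / p * p := (Nat.div_mul_cancel hd).symm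
    have hm0 : n / p ≠ 0 := fun h0 => hn (by rw [hm, h0, zero_mul])
    refine ⟨n / p, p, hm, hp, mod_four_eq_one_of_isSquare hp hodd hd hs, ?_, ?_⟩
    · rwa [he1, pow_one] at hy
    · have hnd : ¬ p ∣ n / p := by
        intro h1
        have : p ^ 2 ∣ n := by rw [sq, hm]; exact Nat.mul_dvd_mul_right h1 p
        have := (hp.pow_dvd_iff_le_factorization hn).1 this
        omega
      have := omegaStar_mul_prime hp hodd hm0
      rwa [if_neg hnd, ← hm] at this
  · left
    -- For `e ≥ 2` one has `3 * ⌊e / 2⌋ ≥ e`; this is the source of the cube.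
    refine ⟨p ^ (e / 2), hy.trans_le ?_, ?_⟩
    · push_cast
      rw [← pow_mul]
      exact pow_le_pow_right₀ hp1 (by omega)
    · rw [← pow_mul]
      exact (pow_dvd_pow p (by omega)).trans (Nat.ordProj_dvd n p)

theorem card_square_dvd_le (N : ℕ) {s₀ : ℕ} (hs : s₀ ≠ 0) (A : Finset ℕ) (hA : A ⊆ Ioc 0 N)
    (h : ∀ n ∈ A, ∃ s, s₀ < s ∧ s ^ 2 ∣ n) : (#A : ℝ) ≤ N / s₀ := by
  classical
  have hsub : A ⊆ (Ioc s₀ N).biUnion fun s => {n ∈ Ioc 0 N | s ^ 2 ∣ n} := by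
    intro n hn
    obtain ⟨s, hs1, hs2⟩ := h n hn
    have hn' := mem_Ioc.1 (hA hn)
    have h1 : s ≤ s ^ 2 := Nat.le_self_pow two_ne_zero s
    have h2 := Nat.le_of_dvd hn'.1 hs2
    exact mem_biUnion.2 ⟨s, mem_Ioc.2 ⟨hs1, by omega⟩, mem_filter.2 ⟨hA hn, hs2⟩⟩
  have hsum : ∑ s ∈ Ioc s₀ N, ((s : ℝ) ^ 2)⁻¹ ≤ (s₀ : ℝ)⁻¹ := by
    rcases le_total s₀ N with hle | hle
    · have h1 := sum_Ioc_inv_sq_le_sub (α := ℝ) hs hle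
      have h2 : (0 : ℝ) ≤ (N : ℝ)⁻¹ := by positivity
      linarith
    · rw [Ioc_eq_empty_of_le hle]; simp
  calc (#A : ℝ) ≤ (∑ s ∈ Ioc s₀ N, #{n ∈ Ioc 0 N | s ^ 2 ∣ n} : ℕ) := by
        exact_mod_cast (card_le_card hsub).trans card_biUnion_le
    _ ≤ ∑ s ∈ Ioc s₀ N, N * ((s : ℝ) ^ 2)⁻¹ := by
        push_cast
        refine sum_le_sum fun s _ => ?_
        rw [Nat.Ioc_filter_dvd_card_eq_div, ← div_eq_mul_inv]
        have := Nat.cast_div_le (α := ℝ) (m := N) (n := s ^ 2)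
        push_cast at this
        exact this
    _ ≤ N * (s₀ : ℝ)⁻¹ := by rw [← mul_sum]; gcongr
    _ = _ := (div_eq_mul_inv _ _).symm

/-- Contribution of the integers `m * p` with a large prime `p`. -/
theorem exists_sum_large_prime_le (K : ℕ) :
    ∃ c B L₀ : ℝ, 0 < c ∧ 0 ≤ B ∧ ∀ L : ℝ, L₀ ≤ L → ∀ j : ℕ, ∀ A : Finset ℕ,
      (∀ n ∈ A, (n : ℝ) ≤ Real.exp (Real.exp L) ∧ IsSquare (-1 : ZMod n) ∧ n ≠ 0 ∧
        ∃ m p : ℕ, n = m * p ∧ p.Prime ∧ p % 4 = 1 ∧ Real.exp (Real.exp L / L ^ 2) < p ∧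
          omegaStar m = j) →
      ∑ n ∈ A, ((repStar R' n).choose (K + 1) : ℝ)
        ≤ (4 * 2 ^ j) ^ (K + 1) * (c * Real.exp (Real.exp L) * L ^ (3 * (K + 2))
          * Real.exp (-((K + 2) * L / 2))) * ((L / 2 + B) ^ j / j.factorial) := by
  classical
  obtain ⟨c, L₀, hc, h⟩ := exists_sum_choose_repStar_mul_prime_le K
  obtain ⟨B, hB0, hB⟩ := exists_sum_inv_prime_sub_one_le
  refine ⟨2 * c, B, max L₀ 1, by positivity, hB0, fun L hL j A hA => ?_⟩
  simp only [max_le_iff] at hL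
  set x := Real.exp (Real.exp L) with hx
  set y := Real.exp (Real.exp L / L ^ 2)
  have hx0 : 0 < x := Real.exp_pos _
  have hL0 : 0 < L := by linarith
  have hx2 : 2 ≤ x := by
    have : 1 ≤ Real.exp L := Real.one_le_exp hL0.le
    linarith [Real.add_one_le_exp (Real.exp L)]
  have hA1 := fun n hn => (hA n hn).1
  have hA2 := fun n hn => (hA n hn).2.1
  have hA3 := fun n hn => (hA n hn).2.2.1
  -- Any choice of factorization serves: the product recovers `n`, so the sum embeds in the sum over
  -- all admissible pairs `(m, p)`.
  choose! m p hnp hp hp4 hyp hω using fun n hn => (hA n hn).2.2.2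
  set N := ⌊x⌋₊
  set D := (splitNumbers N j).filter fun m : ℕ => (m : ℝ) * y ≤ x with hD
  set Q : ℕ → Finset ℕ := fun m => {p ∈ Ioc 0 N | Nat.Prime p ∧ p % 4 ≠ 3 ∧ y < (p : ℝ) ∧ (m * p : ℝ) ≤ x}
    with hQ
  have hmem : ∀ n ∈ A, (⟨m n, p n⟩ : (_ : ℕ) × ℕ) ∈ D.sigma Q := by
    intro n hn
    have e := hnp n hn
    have hm0 : m n ≠ 0 := fun h0 => hA3 n hn (by rw [e, h0, zero_mul])
    have hm1 : 1 ≤ m n := Nat.one_le_iff_ne_zero.2 hm0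
    have hp1 := (hp n hn).one_lt.le
    have hnx : (m n : ℝ) * p n ≤ x := by
      have := hA1 n hn
      rw [e] at this
      exact_mod_cast this
    have hnN : n ≤ N := Nat.le_floor (hA1 n hn)
    have hmy : (m n : ℝ) * y ≤ x := by
      refine le_trans ?_ hnx
      have := (hyp n hn).le
      gcongr
    rw [mem_sigma]
    refine ⟨mem_filter.2 ⟨mem_splitNumbers.2 ⟨⟨hm1, ?_⟩, hω n hn, ?_⟩, hmy⟩, mem_filter.2
      ⟨mem_Ioc.2 ⟨(hp n hn).pos, ?_⟩, hp n hn, by have := hp4 n hn; simp only; omega,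
        hyp n hn, hnx⟩⟩
    · exact (Nat.le_of_dvd (Nat.pos_of_ne_zero (hA3 n hn)) (Dvd.intro _ e.symm)).trans hnN
    · exact ZMod.isSquare_neg_one_of_dvd (Dvd.intro _ e.symm) (hA2 n hn)
    · exact (Nat.le_of_dvd (Nat.pos_of_ne_zero (hA3 n hn)) (Dvd.intro_left _ e.symm)).trans hnN
  set f : ℕ → ℝ := fun n => ((repStar R' n).choose (K + 1) : ℝ) with hf
  have hf0 : ∀ n, 0 ≤ f n := fun n => Nat.cast_nonneg _
  set g : ℕ → (_ : ℕ) × ℕ := fun n => ⟨m n, p n⟩ with hg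
  have hinj : Set.InjOn g (A : Set ℕ) := by
    intro a ha b hb e
    rw [hnp a ha, hnp b hb]
    have : (g a).1 * (g a).2 = (g b).1 * (g b).2 := by rw [e]
    exact this
  set b := (4 * 2 ^ j) ^ (K + 1) * (c * x * L ^ (3 * (K + 2)) * Real.exp (-((K + 2) * L / 2))) with hb
  have hb0 : 0 ≤ b := by positivity
  have hE : (0 : ℝ) ≤ ∑ p ∈ Ioc 0 N with Nat.Prime p ∧ p % 4 = 1, (1 / (p - 1) : ℝ) :=
    sum_nonneg fun p hp => by
      have : (1 : ℝ) < p := by exact_mod_cast (mem_filter.1 hp).2.1.one_lt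
      exact one_div_nonneg.2 (by linarith)
  have hEle : ∑ p ∈ Ioc 0 N with Nat.Prime p ∧ p % 4 = 1, (1 / (p - 1) : ℝ) ≤ L / 2 + B := by
    have := hB x hx2
    rwa [hx, Real.log_exp, Real.log_exp] at this
  calc ∑ n ∈ A, f n = ∑ w ∈ A.image g, f (w.1 * w.2) := by
        rw [sum_image hinj]
        exact sum_congr rfl fun n hn => by rw [← hnp n hn]
    _ ≤ ∑ w ∈ D.sigma Q, f (w.1 * w.2) := by
        refine sum_le_sum_of_subset_of_nonneg (fun w hw => ?_) fun w _ _ => hf0 _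
        obtain ⟨n, hn, rfl⟩ := mem_image.1 hw
        exact hmem n hn
    _ = ∑ m ∈ D, ∑ p ∈ Q m, f (m * p) := sum_sigma _ _ _
    _ ≤ ∑ m ∈ D, b * (1 / m : ℝ) := by
        refine sum_le_sum fun m hm => ?_
        obtain ⟨hm1, hm2⟩ := mem_filter.1 hm
        obtain ⟨hm3, hm4, -⟩ := mem_splitNumbers.1 hm1
        have := h L hL.1 m hm3.1.ne' hm2 (Q m) fun p hp => (mem_filter.1 hp).2
        rw [hm4] at this
        refine this.trans (le_of_eq ?_)
        rw [hb]; ring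
    _ ≤ ∑ m ∈ splitNumbers N j, b * (1 / m : ℝ) :=
        sum_le_sum_of_subset_of_nonneg (filter_subset _ _) fun m _ _ => by positivity
    _ ≤ b * (2 * (L / 2 + B) ^ j / j.factorial) := by
        rw [← mul_sum]
        refine mul_le_mul_of_nonneg_left ((sum_splitNumbers_le N j).trans ?_) hb0
        gcongr
    _ = _ := by rw [hb]; ring

/-! ### Assembling the bound. -/

/-- The target is never smaller than a fixed power of `log x`, so the exceptional integers are
negligible against it. -/
theorem exp_neg_le_pow_div_factorial {C L : ℝ} (hC : 1 ≤ C) (hL : 0 < L) {k : ℕ} (hk : k ≤ C * L) :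
    Real.exp (-(C ^ 2 * L)) ≤ L ^ k / k.factorial := by
  have h1 : (k.factorial : ℝ) ≤ (C * L) ^ k := by
    calc (k.factorial : ℝ) ≤ (k : ℝ) ^ k := by exact_mod_cast Nat.factorial_le_pow k
      _ ≤ _ := by gcongr
  have h2 : C ^ k ≤ Real.exp (C ^ 2 * L) := by
    calc C ^ k ≤ Real.exp C ^ k := by gcongr; linarith [Real.add_one_le_exp C]
      _ = Real.exp (k * C) := (Real.exp_nat_mul _ _).symm
      _ ≤ _ := Real.exp_le_exp.2 (by nlinarith)
  rw [Real.exp_neg, le_div_iff₀ (by positivity), inv_mul_le_iff₀ (Real.exp_pos _)]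
  calc (k.factorial : ℝ) ≤ (C * L) ^ k := h1
    _ = C ^ k * L ^ k := mul_pow _ _ _
    _ ≤ _ := by gcongr

/-- For `j ≤ C * L` the shift by `B` costs only `exp (2 * B * C)`, and passing from `j` to `j + 1`
costs `(j + 1) / (2 ^ K * L) ≤ C`. -/
theorem pow_mul_pow_div_factorial_le {B C L : ℝ} (hB : 0 ≤ B) (hL : 0 < L) {K j : ℕ}
    (hj : ((j + 1 : ℕ) : ℝ) ≤ C * L) :
    (2 ^ j) ^ (K + 1) * ((L / 2 + B) ^ j / j.factorial)
      ≤ C * Real.exp (2 * B * C) * ((2 ^ K * L) ^ (j + 1) / (j + 1).factorial) := by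
  have hC : 0 < C := by
    have : 0 < C * L := lt_of_lt_of_le (by positivity) hj
    exact pos_of_mul_pos_left this hL.le
  push_cast at hj
  have h1 : (L / 2 + B) ^ j ≤ (L / 2) ^ j * Real.exp (2 * B * C) := by
    have e : L / 2 + B = L / 2 * (2 * B / L + 1) := by field_simp; ring
    rw [e, mul_pow]
    gcongr
    calc (2 * B / L + 1) ^ j ≤ Real.exp (2 * B / L) ^ j := by
          gcongr; exact Real.add_one_le_exp _
      _ = Real.exp (j * (2 * B / L)) := (Real.exp_nat_mul _ _).symm
      _ ≤ _ := by
          rw [Real.exp_le_exp]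
          calc j * (2 * B / L) ≤ (C * L) * (2 * B / L) := by gcongr; linarith
            _ = 2 * B * C := by field_simp
  have h2 : (2 ^ j : ℝ) ^ (K + 1) * (L / 2) ^ j = (2 ^ K * L) ^ j := by
    rw [← pow_mul, mul_comm j, pow_mul, ← mul_pow]; congr 1; rw [pow_succ]; ring
  have h3 : (2 ^ K * L) ^ j / (j.factorial : ℝ)
      ≤ C * ((2 ^ K * L) ^ (j + 1) / (j + 1).factorial) := by
    rw [Nat.factorial_succ, pow_succ]
    push_cast
    rw [mul_div_assoc', div_le_div_iff₀ (by positivity) (by positivity)]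
    have h4 : ((j : ℝ) + 1) ≤ C * (2 ^ K * L) := by
      have : (1 : ℝ) ≤ 2 ^ K := one_le_pow₀ (by norm_num)
      calc (j : ℝ) + 1 ≤ C * (1 * L) := by linarith
        _ ≤ _ := by gcongr
    calc (2 ^ K * L) ^ j * (((j : ℝ) + 1) * j.factorial)
        ≤ (2 ^ K * L) ^ j * ((C * (2 ^ K * L)) * j.factorial) := by gcongr
      _ = _ := by ring
  calc (2 ^ j) ^ (K + 1) * ((L / 2 + B) ^ j / j.factorial)
      ≤ (2 ^ j) ^ (K + 1) * ((L / 2) ^ j * Real.exp (2 * B * C) / j.factorial) := by gcongr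
    _ = Real.exp (2 * B * C) * (((2 ^ j : ℝ) ^ (K + 1) * (L / 2) ^ j) / j.factorial) := by ring
    _ = Real.exp (2 * B * C) * ((2 ^ K * L) ^ j / j.factorial) := by rw [h2]
    _ ≤ Real.exp (2 * B * C) * (C * ((2 ^ K * L) ^ (j + 1) / (j + 1).factorial)) := by gcongr
    _ = _ := by ring

/-- The bound with `x = exp (exp L)` and `ℓ = K + 1`. -/
theorem exists_sum_choose_repStar_le (K : ℕ) :
    ∃ c : ℝ, 0 < c ∧ ∀ C : ℝ, 1 ≤ C → ∃ L₀ : ℝ, ∀ L : ℝ, L₀ ≤ L → ∀ k : ℕ, (k : ℝ) ≤ C * L →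
      ∑ n ∈ Icc 1 ⌊Real.exp (Real.exp L)⌋₊ with omegaStar n = k,
          ((repStar R' n).choose (K + 1) : ℝ)
        ≤ c * (Real.exp (Real.exp L) * L ^ (3 * (K + 2) + 1) * Real.exp (-((K + 2) * L / 2))
          * ((2 ^ K * L) ^ k / k.factorial)) := by
  classical
  obtain ⟨c, B, L₁, hc, hB, h⟩ := exists_sum_large_prime_le K
  refine ⟨4 ^ (K + 1) * c + 3 * 4 ^ (K + 1), by positivity, fun C hC => ?_⟩
  -- The powers of `log x` to be beaten by `δ`: from the trivial bound `M`, from the factor `Z`, and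
  -- from the lower bound for `F`.
  set H : ℝ := (K + 1) * C + (K + 2) / 2 + C ^ 2 with hH
  have hH0 : 0 ≤ H := by positivity
  obtain ⟨L₂, hL₂⟩ := Filter.eventually_atTop.1 ((eventually_mul_pow_le_exp 4 0).and
    (eventually_mul_pow_le_exp (3 * H + 3) 3))
  -- Requiring `L ≥ C * exp (2 * B * C)` absorbs the dependence on `C` into one power of `L`, whence
  -- the `+ 1` in the exponent and a `c` free of `C`.
  refine ⟨max (max L₁ L₂) (max (4 * C) (C * Real.exp (2 * B * C))), fun L hL k hk => ?_⟩
  simp only [max_le_iff] at hL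
  obtain ⟨⟨hLL₁, hLL₂⟩, hLC, hLB⟩ := hL
  obtain ⟨hX4, hXH⟩ := hL₂ L hLL₂
  rw [pow_zero, mul_one] at hX4
  have hL4 : 4 ≤ L := by linarith
  have hL0 : 0 < L := by linarith
  set X := Real.exp L with hX
  set x := Real.exp X with hx
  have hX0 : 0 < X := Real.exp_pos L
  have hx0 : 0 < x := Real.exp_pos X
  set y := Real.exp (X / L ^ 2) with hy
  set f : ℕ → ℝ := fun n => ((repStar R' n).choose (K + 1) : ℝ) with hf
  set S := {n ∈ Icc 1 ⌊x⌋₊ | omegaStar n = k} with hS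
  set M : ℝ := (4 * 2 ^ k) ^ (K + 1) with hM
  set F : ℝ := (2 ^ K * L) ^ k / k.factorial with hF
  have hF0 : 0 ≤ F := by positivity
  set Z : ℝ := Real.exp (-((K + 2) * L / 2)) with hZ
  have hZ0 : 0 < Z := Real.exp_pos _
  have hSmem : ∀ n ∈ S, n ≠ 0 ∧ (n : ℝ) ≤ x ∧ omegaStar n = k := by
    intro n hn
    obtain ⟨h1, h2⟩ := mem_filter.1 hn
    obtain ⟨h3, h4⟩ := mem_Icc.1 h1
    exact ⟨by omega, (Nat.le_floor_iff hx0.le).1 h4, h2⟩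
  have hfM : ∀ n ∈ S, f n ≤ M := by
    intro n hn
    obtain ⟨h1, -, h2⟩ := hSmem n hn
    have h3 := repStar_le R' h1
    rw [h2] at h3
    have : (repStar R' n).choose (K + 1) ≤ (4 * 2 ^ k) ^ (K + 1) :=
      (Nat.choose_le_pow _ _).trans (Nat.pow_le_pow_left h3 _)
    simp only [hf, hM]
    exact_mod_cast this
  set A₁ := S.filter fun n : ℕ => (n : ℝ) ≤ Real.exp (X / 2) with hA₁
  set A₂ := S.filter fun n : ℕ => ∃ s : ℕ, y < (s : ℝ) ^ 3 ∧ s ^ 2 ∣ n with hA₂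
  set A₃ := S.filter fun n : ℕ => IsSquare (-1 : ZMod n) ∧ ∃ m p : ℕ, n = m * p ∧ p.Prime ∧
    p % 4 = 1 ∧ y < p ∧ omegaStar n = omegaStar m + 1 with hA₃
  -- As `k ≤ C * L ≤ L ^ 2 / 4`, one has `y ^ k ≤ x ^ (1/4)`, so the dichotomy applies to every `n >
  -- √x`.
  have hyk : 2 * y ^ k ≤ Real.exp (X / 2) := by
    have h1 : y ^ k ≤ Real.exp (X / 4) := by
      rw [hy, ← Real.exp_nat_mul, Real.exp_le_exp]
      calc k * (X / L ^ 2) ≤ (L / 4 * L) * (X / L ^ 2) := by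
            gcongr
            exact hk.trans (by gcongr; linarith)
        _ = X / 4 := by field_simp
    have h2 : 2 ≤ Real.exp (X / 4) := by linarith [Real.add_one_le_exp (X / 4)]
    calc 2 * y ^ k ≤ Real.exp (X / 4) * Real.exp (X / 4) := by gcongr
      _ = Real.exp (X / 2) := by rw [← Real.exp_add]; ring_nf
  have hcover : ∀ n ∈ S, f n ≠ 0 → n ∈ A₁ ∪ A₂ ∪ A₃ := by
    intro n hn hfn
    obtain ⟨h1, h2, h3⟩ := hSmem n hn
    have hpos : 0 < repStar R' n := by
      refine Nat.pos_of_ne_zero fun h0 => hfn ?_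
      simp [hf, h0]
    have hsq := isSquare_neg_one_of_repStar_pos hpos
    rw [mem_union, mem_union]
    by_cases hnx : (n : ℝ) ≤ Real.exp (X / 2)
    · exact Or.inl (Or.inl (mem_filter.2 ⟨hn, hnx⟩))
    have h4 : 2 * y ^ omegaStar n < n := by rw [h3]; linarith
    rcases exists_large_prime_or_square_dvd h1 hsq h4 with h5 | h5
    · exact Or.inl (Or.inr (mem_filter.2 ⟨hn, h5⟩))
    · exact Or.inr (mem_filter.2 ⟨hn, hsq, h5⟩)
  have hf0 : ∀ n, 0 ≤ f n := fun n => Nat.cast_nonneg _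
  have hsplit : ∑ n ∈ S, f n ≤ ∑ n ∈ A₁, f n + ∑ n ∈ A₂, f n + ∑ n ∈ A₃, f n := by
    have e0 : ∑ n ∈ S, f n ≤ ∑ n ∈ A₁ ∪ A₂ ∪ A₃, f n := by
      rw [← sum_filter_ne_zero]
      refine sum_le_sum_of_subset_of_nonneg (fun n hn => ?_) fun n _ _ => hf0 n
      exact hcover n (mem_filter.1 hn).1 (mem_filter.1 hn).2
    have e1 := sum_union_inter (s₁ := A₁ ∪ A₂) (s₂ := A₃) (f := f)
    have e2 := sum_union_inter (s₁ := A₁) (s₂ := A₂) (f := f)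
    have e3 : 0 ≤ ∑ n ∈ (A₁ ∪ A₂) ∩ A₃, f n := sum_nonneg fun n _ => hf0 n
    have e4 : 0 ≤ ∑ n ∈ A₁ ∩ A₂, f n := sum_nonneg fun n _ => hf0 n
    linarith
  have hIoc : S ⊆ Ioc 0 ⌊x⌋₊ := fun n hn => (mem_filter.1 hn).1
  -- This is `y ^ (-1/3)`, the order of the tail of `∑ 1 / s ^ 2` over `s > y ^ (1/3)`.
  set δ := Real.exp (-(X / (3 * L ^ 2))) with hδ
  have hcard₁ : (#A₁ : ℝ) ≤ x * δ := by
    have h1 : A₁ ⊆ Ioc 0 ⌊Real.exp (X / 2)⌋₊ := by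
      intro n hn
      obtain ⟨h1, h2⟩ := mem_filter.1 hn
      exact mem_Ioc.2 ⟨(mem_Ioc.1 (hIoc h1)).1, Nat.le_floor h2⟩
    have h2 := card_le_card h1
    rw [Nat.card_Ioc, Nat.sub_zero] at h2
    calc (#A₁ : ℝ) ≤ ⌊Real.exp (X / 2)⌋₊ := by exact_mod_cast h2
      _ ≤ Real.exp (X / 2) := Nat.floor_le (Real.exp_pos _).le
      _ ≤ Real.exp (X + -(X / (3 * L ^ 2))) := by
          rw [Real.exp_le_exp]
          have : X / (3 * L ^ 2) ≤ X / 2 := by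
            gcongr
            nlinarith
          linarith
      _ = _ := Real.exp_add _ _
  have hcard₂ : (#A₂ : ℝ) ≤ 2 * (x * δ) := by
    set Y := Real.exp (X / (3 * L ^ 2)) with hY
    have hY3 : Y ^ 3 = y := by
      rw [hY, ← Real.exp_nat_mul, hy]; congr 1; push_cast; field_simp
    have hY2 : 2 ≤ Y := by
      have : 1 ≤ X / (3 * L ^ 2) := by
        rw [one_le_div (by positivity)]
        have : L ^ 2 ≤ L ^ 3 := pow_le_pow_right₀ (by linarith) (by norm_num)
        nlinarith [pow_pos hL0 2, mul_nonneg hH0 (pow_pos hL0 3).le]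
      linarith [Real.add_one_le_exp (X / (3 * L ^ 2))]
    have hs0 : Y / 2 ≤ ⌊Y⌋₊ := by
      have := Nat.lt_floor_add_one Y
      linarith
    have hs1 : ⌊Y⌋₊ ≠ 0 := (Nat.floor_pos.2 (by linarith)).ne'
    have h1 := card_square_dvd_le ⌊x⌋₊ hs1 A₂ ((filter_subset _ _).trans hIoc) (fun n hn => by
      obtain ⟨s, hs, hd⟩ := (mem_filter.1 hn).2
      refine ⟨s, ?_, hd⟩
      rw [← hY3] at hs
      have : Y < s := lt_of_pow_lt_pow_left₀ 3 (Nat.cast_nonneg s) hs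
      exact (Nat.floor_lt (by linarith)).2 this)
    calc (#A₂ : ℝ) ≤ (⌊x⌋₊ : ℝ) / ⌊Y⌋₊ := h1
      _ ≤ x / (Y / 2) := by
          gcongr
          exact Nat.floor_le hx0.le
      _ = _ := by rw [hδ, Real.exp_neg, ← hY]; field_simp
  have hsum₁₂ : ∑ n ∈ A₁, f n + ∑ n ∈ A₂, f n ≤ 3 * (x * δ) * M := by
    have h1 := sum_le_card_nsmul A₁ f M fun n hn => hfM n (filter_subset _ _ hn)
    have h2 := sum_le_card_nsmul A₂ f M fun n hn => hfM n (filter_subset _ _ hn)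
    rw [nsmul_eq_mul] at h1 h2
    have hM0 : 0 ≤ M := by positivity
    have h3 := mul_le_mul_of_nonneg_right hcard₁ hM0
    have h4 := mul_le_mul_of_nonneg_right hcard₂ hM0
    linarith
  have hLA : 1 ≤ L ^ (3 * (K + 2) + 1) := one_le_pow₀ (by linarith)
  have hsmall : 3 * (x * δ) * M ≤ 3 * 4 ^ (K + 1) * (x * L ^ (3 * (K + 2) + 1) * Z * F) := by
    have hM2 : M ≤ 4 ^ (K + 1) * Real.exp ((K + 1) * C * L) := by
      rw [hM, mul_pow]
      gcongr
      calc ((2 : ℝ) ^ k) ^ (K + 1) ≤ (Real.exp 1 ^ k) ^ (K + 1) := by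
            gcongr; linarith [Real.exp_one_gt_d9]
        _ = Real.exp ((K + 1) * k) := by
            rw [← Real.exp_nat_mul, ← Real.exp_nat_mul]; push_cast; ring_nf
        _ ≤ _ := by
            rw [Real.exp_le_exp, mul_assoc]; gcongr
    have hF2 : Real.exp (-(C ^ 2 * L)) ≤ F := by
      refine (exp_neg_le_pow_div_factorial hC hL0 hk).trans ?_
      rw [hF]
      gcongr
      exact le_mul_of_one_le_left hL0.le (one_le_pow₀ (by norm_num))
    have hexp : δ * Real.exp ((K + 1) * C * L) ≤ Z * F := by
      calc δ * Real.exp ((K + 1) * C * L) ≤ Z * Real.exp (-(C ^ 2 * L)) := by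
            rw [hδ, hZ, ← Real.exp_add, ← Real.exp_add, Real.exp_le_exp]
            have : H * L ≤ X / (3 * L ^ 2) := by
              rw [le_div_iff₀ (by positivity)]
              nlinarith [pow_pos hL0 3]
            rw [hH] at this
            linarith
        _ ≤ _ := by gcongr
    calc 3 * (x * δ) * M ≤ 3 * (x * δ) * (4 ^ (K + 1) * Real.exp ((K + 1) * C * L)) := by gcongr
      _ = 3 * 4 ^ (K + 1) * (x * 1 * (δ * Real.exp ((K + 1) * C * L))) := by ring
      _ ≤ 3 * 4 ^ (K + 1) * (x * L ^ (3 * (K + 2) + 1) * (Z * F)) := by gcongr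
      _ = _ := by ring
  have hlarge : ∑ n ∈ A₃, f n ≤ 4 ^ (K + 1) * c * (x * L ^ (3 * (K + 2) + 1) * Z * F) := by
    rcases A₃.eq_empty_or_nonempty with h0 | ⟨n₀, hn₀⟩
    · rw [h0, sum_empty]; positivity
    -- Members of `A₃` have an odd prime factor, so `k = 0` is covered by the empty case.
    obtain ⟨j, rfl⟩ : ∃ j, k = j + 1 := by
      obtain ⟨h1, -, m, p, -, -, -, -, h2⟩ := mem_filter.1 hn₀
      exact ⟨omegaStar m, by rw [← h2, (hSmem _ h1).2.2]⟩
    have h1 := h L hLL₁ j A₃ fun n hn => by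
      obtain ⟨h1, h2, m, p, h3, h4, h5, h6, h7⟩ := mem_filter.1 hn
      obtain ⟨h8, h9, h10⟩ := hSmem n h1
      exact ⟨h9, h2, h8, m, p, h3, h4, h5, h6, by omega⟩
    refine h1.trans ?_
    have h2 := pow_mul_pow_div_factorial_le (K := K) hB hL0 hk
    calc (4 * 2 ^ j) ^ (K + 1) * (c * x * L ^ (3 * (K + 2)) * Z) * ((L / 2 + B) ^ j / j.factorial)
        = 4 ^ (K + 1) * c * (x * L ^ (3 * (K + 2)) * Z)
          * ((2 ^ j) ^ (K + 1) * ((L / 2 + B) ^ j / j.factorial)) := by rw [mul_pow]; ring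
      _ ≤ 4 ^ (K + 1) * c * (x * L ^ (3 * (K + 2)) * Z) * (C * Real.exp (2 * B * C) * F) := by
          gcongr
      _ ≤ 4 ^ (K + 1) * c * (x * L ^ (3 * (K + 2)) * Z) * (L * F) := by gcongr
      _ = _ := by rw [pow_succ]; ring
  linarith

end SumSq

/-- The constants `A` (the exponent `O_ℓ(1)`) and `c` depend only on `ℓ`. The hypothesis `k ≪ L` is
`k ≤ C * L` for an arbitrary fixed `C`; only the threshold `x₀` may depend on `C`. -/
theorem mainTheorem2 (ℓ : ℕ) (hℓ : 1 ≤ ℓ) :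
    ∃ A c : ℝ, 0 < c ∧ ∀ C : ℝ, ∃ x₀ : ℝ, ∀ x : ℝ, x₀ ≤ x →
      ∀ k : ℕ, (k : ℝ) ≤ C * Real.log (Real.log x) →
        ∑ n ∈ (Finset.Icc 1 ⌊x⌋₊).filter (fun n => SumSq.omegaStar n = k),
            ((SumSq.repStar SumSq.R' n).choose ℓ : ℝ)
          ≤ c * (x * Real.log (Real.log x) ^ A / Real.sqrt (Real.log x) ^ (ℓ + 1)
              * ((2 ^ (ℓ - 1) * Real.log (Real.log x)) ^ k / (k.factorial : ℝ))) := by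
  obtain ⟨K, rfl⟩ : ∃ K, ℓ = K + 1 := ⟨ℓ - 1, by omega⟩
  obtain ⟨c, hc, h⟩ := SumSq.exists_sum_choose_repStar_le K
  refine ⟨((3 * (K + 2) + 1 : ℕ) : ℝ), c, hc, fun C => ?_⟩
  obtain ⟨L₀, hL₀⟩ := h (max C 1) (le_max_right _ _)
  -- The maximum with 0 ensures `L ≥ 0`, needed to replace `C` by `max C 1`.
  refine ⟨Real.exp (Real.exp (max L₀ 0)), fun x hx k hk => ?_⟩
  have hx0 : 0 < x := (Real.exp_pos _).trans_le hx
  have h1 : Real.exp (max L₀ 0) ≤ Real.log x := (Real.le_log_iff_exp_le hx0).2 hx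
  have hlog0 : 0 < Real.log x := (Real.exp_pos _).trans_le h1
  have h2 : max L₀ 0 ≤ Real.log (Real.log x) := (Real.le_log_iff_exp_le hlog0).2 h1
  set L := Real.log (Real.log x) with hL
  have e1 : Real.exp L = Real.log x := Real.exp_log hlog0
  have e2 : Real.exp (Real.exp L) = x := by rw [e1, Real.exp_log hx0]
  have hkL : (k : ℝ) ≤ max C 1 * L := by
    refine hk.trans ?_
    gcongr
    · exact (le_max_right _ _).trans h2
    · exact le_max_left _ _
  have := hL₀ L ((le_max_left _ _).trans h2) k hkL
  rw [e2] at this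
  refine this.trans (le_of_eq ?_)
  have e3 : Real.exp (-((K + 2) * L / 2)) = 1 / Real.sqrt (Real.log x) ^ (K + 1 + 1) := by
    rw [← e1, Real.sqrt_eq_rpow, ← Real.exp_mul, ← Real.exp_nat_mul, one_div, ← Real.exp_neg]
    congr 1
    push_cast
    ring
  rw [e3, Real.rpow_natCast, Nat.add_sub_cancel, mul_one_div]
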